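/- Let $H^k(\mathbb R)$ be the real Sobolev spaces and $X^k(\mathbb R)=H^{k+1}(\mathbb R)\times H^k(\mathbb R)$. For $0<|c|<\sqrt2$ put $$\eta_c(x)=\frac{2-c^2}{2\cosh^2\!\big(\tfrac{\sqrt{2-c^2}}{2}x\big)},\qquad v_c=\frac{c\,\eta_c}{2(1-\eta_c)},\qquad Q_c=(\eta_c,v_c),\qquad \mu_c=\eta_c+\partial_{xx}\eta_c ,$$ and, for $u=(u_1,u_2)\in X^1(\mathbb R)$, $$G_c(u)=2\int_{\mathbb R}\mu_c\Big(u_2-\frac{c\,\eta_c}{2\mu_c}u_1-\frac{c\,\partial_x\eta_c}{2(1-\eta_c)\mu_c}\partial_xu_1\Big)^2dx+\frac32\int_{\mathbb R}\frac{\eta_c^2}{\mu_c}\Big(\partial_xu_1-\frac{\partial_x\eta_c}{\eta_c}u_1\Big)^2dx .$$ Let also $$S=\begin{pmatrix}0&1\\1&0\end{pmatrix},\qquad J=-2S\partial_x,\qquad M_c=\begin{pmatrix}-\frac{c\,\partial_x\eta_c}{2(1-\eta_c)^2}&-\frac{\partial_x\eta_c}{\eta_c}\\-\frac{\partial_x\eta_c}{\eta_c}&0\end{pmatrix},$$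 $$\mathcal H_c(\varepsilon)=\begin{pmatrix}-\frac14\partial_x\Big(\frac{\partial_x\varepsilon_1}{1-\eta_c}\Big)+\frac14\Big(2-\frac{\partial_{xx}\eta_c}{(1-\eta_c)^2}-\frac{(\partial_x\eta_c)^2}{(1-\eta_c)^3}\Big)\varepsilon_1-\Big(\frac c2+v_c\Big)\varepsilon_2\\-\Big(\frac c2+v_c\Big)\varepsilon_1+(1-\eta_c)\varepsilon_2\end{pmatrix}.$$ Then the following hold. (1) For every $0<|c|<\sqrt2$ and every $u\in X^3(\mathbb R)$, $G_c(u)=2\langle SM_cu,\mathcal H_c(JSu)\rangle_{L^2(\mathbb R)^2}$. (2) For every $0<|c|<\sqrt2$ there is a number $\Lambda_c>0$, depending only on $c$, and continuously on $c\in(-\sqrt2,\sqrt2)\setminus\{0\}$, such that $$G_c(u)\ \ge\ \Lambda_c\int_{\mathbb R}\big[(\partial_xu_1)^2+u_1^2+u_2^2\big](x)\,e^{-\sqrt2|x|}\,dx$$ for every pair $u=(u_1,u_2)\in X^1(\mathbb R)$ such that $\langle u,S\,\partial_cQ_c\rangle_{L^2(\mathbb R)^2}=0$, that is, $\int_{\mathbb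 R}\big(u_1\,\partial_cv_c+u_2\,\partial_c\eta_c\big)\,dx=0$. -/

import Mathlib

namespace DarkSoliton

open MeasureTheory

noncomputable section

/-! ### Sobolev spaces on the real line -/

/-- `g` is the weak (distributional) derivative on `ℝ` of the locally integrable function `f`. -/
def IsWeakDeriv (f g : ℝ → ℝ) : Prop :=
  LocallyIntegrable f ∧ LocallyIntegrable g ∧
    ∀ φ : ℝ → ℝ, ContDiff ℝ (⊤ : ℕ∞) φ → HasCompactSupport φ →
      ∫ x, f x * deriv φ x = -∫ x, g x * φ x

open Classical in
/-- A weak derivative of `f` (unique up to a null set); the value is `0` if there is none. -/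
def weakDeriv (f : ℝ → ℝ) : ℝ → ℝ :=
  if h : ∃ g, IsWeakDeriv f g then h.choose else 0

/-- Membership in the Sobolev space `H^k(ℝ)`: `f` and its weak derivatives up to order `k` are
square integrable. -/
def MemH : ℕ → (ℝ → ℝ) → Prop
  | 0, f => MemLp f 2 volume
  | k + 1, f => MemLp f 2 volume ∧ ∃ g, IsWeakDeriv f g ∧ MemH k g

/-- Pairs of real functions on `ℝ`. -/
abbrev Pair : Type := (ℝ → ℝ) × (ℝ → ℝ)

/-- Membership in `X^k(ℝ) = H^{k+1}(ℝ) × H^k(ℝ)`. -/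
def MemX (k : ℕ) (u : Pair) : Prop :=
  MemH (k + 1) u.1 ∧ MemH k u.2

/-- The scalar product of `L²(ℝ)²`. -/
def innerL2 (u w : Pair) : ℝ :=
  ∫ x, (u.1 x * w.1 x + u.2 x * w.2 x)

/-! ### The solitons in hydrodynamical variables -/

/-- `η_c(x) = (2 - c²) / (2 ch(√(2 - c²) x / 2)²)`. -/
def eta (c x : ℝ) : ℝ :=
  (2 - c ^ 2) / (2 * Real.cosh (Real.sqrt (2 - c ^ 2) / 2 * x) ^ 2)

/-- `v_c = c η_c / (2 (1 - η_c))`. -/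
def vel (c x : ℝ) : ℝ :=
  c * eta c x / (2 * (1 - eta c x))

/-- `∂ₓ η_c`. -/
def etaX (c x : ℝ) : ℝ :=
  deriv (eta c) x

/-- `∂ₓₓ η_c`. -/
def etaXX (c x : ℝ) : ℝ :=
  deriv (etaX c) x

/-- `∂_c Q_c = (∂_c η_c, ∂_c v_c)`, where `Q_c = (η_c, v_c)`. -/
def dcQ (c : ℝ) : Pair :=
  (fun x => deriv (fun s => eta s x) c, fun x => deriv (fun s => vel s x) c)

/-! ### The operators `S`, `J`, `M_c`, `H_c` -/

/-- `S = (0 1; 1 0)`. -/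
def opS (u : Pair) : Pair :=
  (u.2, u.1)

/-- `J = -2 S ∂ₓ`. -/
def opJ (u : Pair) : Pair :=
  opS (fun x => -2 * weakDeriv u.1 x, fun x => -2 * weakDeriv u.2 x)

/-- Multiplication by the symmetric matrix `M_c` with rows
`(-c ∂ₓη_c / (2 (1 - η_c)²), -∂ₓη_c / η_c)` and `(-∂ₓη_c / η_c, 0)`. -/
def opM (c : ℝ) (u : Pair) : Pair :=
  (fun x => -(c * etaX c x / (2 * (1 - eta c x) ^ 2)) * u.1 x
      + -(etaX c x / eta c x) * u.2 x,
   fun x => -(etaX c x / eta c x) * u.1 x + 0 * u.2 x)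

/-- The operator `H_c = E''(Q_c) - c P''(Q_c)`, with domain `H²(ℝ) × L²(ℝ)`. -/
def opH (c : ℝ) (ε : Pair) : Pair :=
  (fun x => -(1 / 4) * weakDeriv (fun y => weakDeriv ε.1 y / (1 - eta c y)) x
      + 1 / 4 * (2 - etaXX c x / (1 - eta c x) ^ 2 - etaX c x ^ 2 / (1 - eta c x) ^ 3) * ε.1 x
      - (c / 2 + vel c x) * ε.2 x,
   fun x => -(c / 2 + vel c x) * ε.1 x + (1 - eta c x) * ε.2 x)

/-! ### The quadratic form `G_c` -/

/-- `μ_c = η_c + ∂ₓₓ η_c`. -/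
def mu (c x : ℝ) : ℝ :=
  eta c x + etaXX c x

/-- The quadratic form `G_c` on `X¹(ℝ)`. -/
def G (c : ℝ) (u : Pair) : ℝ :=
  2 * (∫ x, mu c x * (u.2 x - c * eta c x / (2 * mu c x) * u.1 x
      - c * etaX c x / (2 * (1 - eta c x) * mu c x) * weakDeriv u.1 x) ^ 2)
    + 3 / 2 * (∫ x, eta c x ^ 2 / mu c x
      * (weakDeriv u.1 x - etaX c x / eta c x * u.1 x) ^ 2)

end

end DarkSoliton

/-! Put τ = -∂ₓη/η. Then τ' = η and τ² = 2 - c² - 2η, so η' = -τη, and every soliton identity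
becomes a rational identity in c and τ.

Part (1) is a conservation law. For regular u, the density of 2⟨S M u, H(JSu)⟩ minus the density of
G is the x-derivative of an explicit `flux`, bilinear in u and its derivatives with bounded
coefficients. It is integrable, so its derivative has integral zero (`hasDerivAt_flux`,
`integral_ham_eq`).

For part (2), write G = 2∫μ r² + (3/2)∫(η²/μ) s² with r = `resid` and s = `slope`. If s = r = 0,
then u₁ = mη, and `snd_eq` gives u₂ = m v, so the form degenerates only along Q_c. This direction is
excluded by the constraint, because the pairing of Q_c with S∂_cQ_c is ∫∂_c(ηv) = -2√(2 - c²) ≠ 0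
(`integral_eta_velC_add_vel_etaC`).

To make this quantitative, take m = u₁(0)/η(0). Since (u₁/η)' = s/η, Cauchy–Schwarz bounds the
deviation u₁ - mη by ∫η s² with growth at most |x| e^{√(2-c²)|x|} in its square
(`dev_sq_mul_eta_le`). This is summable against e^{-σ|x|} as soon as σ > √(2 - c²) (`wNorm_dev_le`).
The constraint then bounds m by pairing the remainder with ∂_cQ_c, which is of size (1 + |x|)η; the
dual weight e^{σ|x|} is affordable if σ < 2√(2 - c²) (`mult_sq_le`). Finally σ ≤ √2 makes e^{-√2|x|}
the smaller weight. A rate σ with all three properties exists because c ≠ 0 gives √(2 - c²) < √2.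
All constants are explicit in c, whence the continuity of Λ. -/

namespace DarkSoliton

open MeasureTheory Set

/-! ### Weak derivatives and regular representatives of Sobolev functions -/

theorem IsWeakDeriv.ae_eq {f f' g g' : ℝ → ℝ} (h : IsWeakDeriv f g) (h' : IsWeakDeriv f' g')
    (hf : f =ᵐ[volume] f') : g =ᵐ[volume] g' := by
  refine ae_eq_of_integral_contDiff_smul_eq h.2.1 h'.2.1 fun φ hφ hc => ?_
  have h1 := h.2.2 φ hφ hc
  have h2 := h'.2.2 φ hφ hc
  have h3 : ∫ x, f x * deriv φ x = ∫ x, f' x * deriv φ x :=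
    integral_congr_ae (hf.mono fun x hx => by simp only [hx])
  simp only [smul_eq_mul, mul_comm (φ _)]
  linarith

theorem IsWeakDeriv.congr {f f' g g' : ℝ → ℝ} (h : IsWeakDeriv f g) (hf : f =ᵐ[volume] f')
    (hg : g =ᵐ[volume] g') : IsWeakDeriv f' g' := by
  refine ⟨(locallyIntegrable_congr hf).1 h.1, (locallyIntegrable_congr hg).1 h.2.1,
    fun φ hφ hc => ?_⟩
  have h1 : ∫ x, f x * deriv φ x = ∫ x, f' x * deriv φ x :=
    integral_congr_ae (hf.mono fun x hx => by simp only [hx])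
  have h2 : ∫ x, g x * φ x = ∫ x, g' x * φ x :=
    integral_congr_ae (hg.mono fun x hx => by simp only [hx])
  rw [← h1, ← h2]
  exact h.2.2 φ hφ hc

theorem isWeakDeriv_of_hasDerivAt {F F' : ℝ → ℝ} (h : ∀ x, HasDerivAt F (F' x) x)
    (hF' : Continuous F') : IsWeakDeriv F F' := by
  have hF : Continuous F := continuous_iff_continuousAt.2 fun x => (h x).continuousAt
  refine ⟨hF.locallyIntegrable, hF'.locallyIntegrable, fun φ hφ hc => ?_⟩
  have hφ' : Continuous (deriv φ) := hφ.continuous_deriv (by simp)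
  refine integral_mul_deriv_eq_deriv_mul_of_integrable (fun x _ => h x)
    (fun x _ => (hφ.differentiable (by simp) x).hasDerivAt) ?_ ?_ ?_
  · exact (hF.mul hφ').integrable_of_hasCompactSupport hc.deriv.mul_left
  · exact (hF'.mul hφ.continuous).integrable_of_hasCompactSupport hc.mul_left
  · exact (hF.mul hφ.continuous).integrable_of_hasCompactSupport hc.mul_left

theorem IsWeakDeriv.weakDeriv_ae_eq {f g : ℝ → ℝ} (h : IsWeakDeriv f g) :
    weakDeriv f =ᵐ[volume] g := by
  have hex : ∃ g, IsWeakDeriv f g := ⟨g, h⟩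
  rw [weakDeriv, dif_pos hex]
  exact hex.choose_spec.ae_eq h Filter.EventuallyEq.rfl

/-- `weakDeriv` is an arbitrary choice; this is the passage from it to the classical derivative of a
C¹ representative, where all computations take place. -/
theorem weakDeriv_ae_eq {f F F' : ℝ → ℝ} (hf : f =ᵐ[volume] F) (h : ∀ x, HasDerivAt F (F' x) x)
    (hF' : Continuous F') : weakDeriv f =ᵐ[volume] F' :=
  ((isWeakDeriv_of_hasDerivAt h hF').congr hf.symm Filter.EventuallyEq.rfl).weakDeriv_ae_eq

theorem _root_.MeasureTheory.LocallyIntegrable.intervalIntegrable' {g : ℝ → ℝ}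
    (hg : LocallyIntegrable g) (a b : ℝ) : IntervalIntegrable g volume a b :=
  (hg.integrableOn_isCompact isCompact_uIcc).intervalIntegrable

/-- Integration by parts for the primitive of a locally integrable function. -/
theorem isWeakDeriv_primitive {g : ℝ → ℝ} (hg : LocallyIntegrable g) :
    IsWeakDeriv (fun x => ∫ t in (0 : ℝ)..x, g t) g := by
  have hint : ∀ a b, IntervalIntegrable g volume a b := hg.intervalIntegrable'
  have hcont : Continuous fun x => ∫ t in (0 : ℝ)..x, g t :=
    intervalIntegral.continuous_primitive hint 0
  refine ⟨hcont.locallyIntegrable, hg, fun φ hφ hc => ?_⟩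
  have hφ' : Continuous (deriv φ) := hφ.continuous_deriv (by simp)
  obtain ⟨R, hR0, hR⟩ : ∃ R : ℝ, 0 < R ∧ tsupport φ ⊆ Ioo (-R) R := by
    obtain ⟨R, hR⟩ := hc.isCompact.isBounded.subset_ball_lt 0 0
    exact ⟨R, hR.1, by simpa [Real.ball_eq_Ioo] using hR.2⟩
  have hφ0 : ∀ x, x ∉ Ioo (-R) R → φ x = 0 := fun x hx =>
    image_eq_zero_of_notMem_tsupport fun h => hx (hR h)
  have hd0 : ∀ x, x ∉ Ioo (-R) R → deriv φ x = 0 := fun x hx =>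
    image_eq_zero_of_notMem_tsupport fun h => hx (hR (tsupport_deriv_subset h))
  have key : ∀ u : ℝ → ℝ, (∀ x, x ∉ Ioo (-R) R → u x = 0) →
      ∫ x, u x = ∫ x in (-R)..R, u x := by
    intro u hu
    rw [intervalIntegral.integral_of_le (by linarith)]
    symm
    apply setIntegral_eq_integral_of_forall_compl_eq_zero
    intro x hx
    exact hu x fun h => hx ⟨h.1, h.2.le⟩
  rw [key _ fun x hx => by rw [hd0 x hx, mul_zero], key _ fun x hx => by rw [hφ0 x hx, mul_zero]]
  -- With g only locally integrable the primitive need not be differentiable everywhere, so the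
  -- integration by parts relies on absolute continuity.
  have hac : AbsolutelyContinuousOnInterval (fun x => ∫ t in (0 : ℝ)..x, g t) (-R) R :=
    (hint (-R) R).absolutelyContinuousOnInterval_intervalIntegral
      (by rw [uIcc_of_le (by linarith)]; constructor <;> linarith)
  have hφac : AbsolutelyContinuousOnInterval φ (-R) R := by
    obtain ⟨K, hK⟩ := (hφ.of_le (by simp) : ContDiff ℝ 1 φ).lipschitzWith_of_hasCompactSupport hc
      (by simp)
    exact (hK.lipschitzOnWith (s := uIcc (-R) R)).absolutelyContinuousOnInterval
  rw [hac.integral_mul_deriv_eq_deriv_mul hφac, hφ0 R (by simp), hφ0 (-R) (by simp)]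
  simp only [mul_zero, sub_zero, zero_sub, neg_inj]
  refine intervalIntegral.integral_congr_ae ?_
  filter_upwards [LocallyIntegrable.ae_hasDerivAt_integral hg] with x hx _
  rw [(hx 0).deriv]

/-- A function whose weak derivative vanishes is constant. -/
theorem IsWeakDeriv.ae_eq_const {f : ℝ → ℝ} (h : IsWeakDeriv f 0) :
    ∃ C : ℝ, f =ᵐ[volume] fun _ => C := by
  let b : ContDiffBump (0 : ℝ) := ⟨1, 2, by norm_num, by norm_num⟩
  let ρ : ℝ → ℝ := b.normed volume
  have hρ : ContDiff ℝ (⊤ : ℕ∞) ρ := b.contDiff_normed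
  have hρc : HasCompactSupport ρ := b.hasCompactSupport_normed
  have hρi : Integrable ρ := hρ.continuous.integrable_of_hasCompactSupport hρc
  have hρ1 : ∫ x, ρ x = 1 := b.integral_normed
  refine ⟨∫ x, f x * ρ x, ?_⟩
  refine ae_eq_of_integral_contDiff_smul_eq h.1 continuous_const.locallyIntegrable
    fun χ hχ hχc => ?_
  have hχi : Integrable χ := hχ.continuous.integrable_of_hasCompactSupport hχc
  -- Removing the mean of χ makes the primitive of ψ a test function. Then ∫ f ψ = 0, which says ∫ f
  -- χ = (∫ f ρ)(∫ χ).
  let ψ : ℝ → ℝ := fun x => χ x - (∫ y, χ y) * ρ x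
  have hψ : ContDiff ℝ (⊤ : ℕ∞) ψ := hχ.sub (contDiff_const.mul hρ)
  have hψc : HasCompactSupport ψ := hχc.sub (hρc.mul_left (f := fun _ => ∫ y, χ y))
  have hψi : Integrable ψ := hψ.continuous.integrable_of_hasCompactSupport hψc
  have hψ0 : ∫ x, ψ x = 0 := by
    simp only [ψ]
    rw [integral_sub hχi (hρi.const_mul _), integral_const_mul, hρ1, mul_one, sub_self]
  obtain ⟨R, hR0, hR⟩ : ∃ R : ℝ, 0 < R ∧ tsupport ψ ⊆ Ioo (-R) R := by
    obtain ⟨R, hR⟩ := hψc.isCompact.isBounded.subset_ball_lt 0 0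
    exact ⟨R, hR.1, by simpa [Real.ball_eq_Ioo] using hR.2⟩
  have hψz : ∀ x, x ∉ Ioo (-R) R → ψ x = 0 := fun x hx =>
    image_eq_zero_of_notMem_tsupport fun h => hx (hR h)
  let φ : ℝ → ℝ := fun x => ∫ t in (-R)..x, ψ t
  have hφd : ∀ x, HasDerivAt φ (ψ x) x := fun x =>
    intervalIntegral.integral_hasDerivAt_right (hψ.continuous.intervalIntegrable _ _)
      (hψ.continuous.stronglyMeasurableAtFilter _ _) hψ.continuous.continuousAt
  have hφd' : deriv φ = ψ := funext fun x => (hφd x).deriv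
  have hφ : ContDiff ℝ (⊤ : ℕ∞) φ := by
    rw [contDiff_infty_iff_deriv, hφd']
    exact ⟨fun x => (hφd x).differentiableAt, hψ⟩
  have hφc : HasCompactSupport φ := by
    refine HasCompactSupport.of_support_subset_isCompact (isCompact_Icc (a := -R) (b := R)) ?_
    intro x hx
    by_contra hx'
    apply hx
    rw [mem_Icc, not_and_or, not_le, not_le] at hx'
    rcases hx' with hx' | hx'
    · refine (intervalIntegral.integral_congr (g := fun _ => 0) ?_).trans (by simp)
      intro t ht
      rw [uIcc_of_ge hx'.le] at ht
      exact hψz t fun h => absurd h.1 (not_lt.2 ht.2)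
    · show ∫ t in (-R)..x, ψ t = 0
      rw [← hψ0, intervalIntegral.integral_of_le (by linarith)]
      apply setIntegral_eq_integral_of_forall_compl_eq_zero
      intro t ht
      exact hψz t fun h => ht ⟨h.1, by linarith [h.2]⟩
  have h1 := h.2.2 φ hφ hφc
  rw [hφd'] at h1
  simp only [Pi.zero_apply, zero_mul, integral_zero, neg_zero, ψ, mul_sub] at h1
  have hfc : ∀ u : ℝ → ℝ, Continuous u → HasCompactSupport u → Integrable fun x => f x * u x :=
    fun u hu huc => by simpa only [smul_eq_mul, mul_comm] using
      h.1.integrable_smul_left_of_hasCompactSupport hu huc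
  have h2 : ∀ x, f x * ((∫ y, χ y) * ρ x) = (∫ y, χ y) * (f x * ρ x) := fun x => by ring
  simp only [h2] at h1
  rw [integral_sub (hfc χ hχ.continuous hχc) ((hfc ρ hρ.continuous hρc).const_mul _),
    integral_const_mul] at h1
  simp only [smul_eq_mul, integral_mul_const]
  simp only [mul_comm (χ _)]
  linarith

theorem IsWeakDeriv.ae_eq_primitive {f g : ℝ → ℝ} (h : IsWeakDeriv f g) :
    ∃ C : ℝ, f =ᵐ[volume] fun x => C + ∫ t in (0 : ℝ)..x, g t := by
  have hP := isWeakDeriv_primitive h.2.1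
  set P : ℝ → ℝ := fun x => ∫ t in (0 : ℝ)..x, g t
  have h0 : IsWeakDeriv (fun x => f x - P x) 0 := by
    refine ⟨h.1.sub hP.1, (continuous_const (y := (0 : ℝ))).locallyIntegrable,
      fun φ hφ hc => ?_⟩
    have hφ' : Continuous (deriv φ) := hφ.continuous_deriv (by simp)
    have hi : ∀ u : ℝ → ℝ, LocallyIntegrable u → Integrable fun x => u x * deriv φ x :=
      fun u hu => by simpa only [smul_eq_mul, mul_comm] using
        hu.integrable_smul_left_of_hasCompactSupport hφ' hc.deriv
    simp only [sub_mul, Pi.zero_apply, zero_mul, integral_zero, neg_zero]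
    rw [integral_sub (hi _ h.1) (hi _ hP.1), h.2.2 φ hφ hc, hP.2.2 φ hφ hc, sub_self]
  obtain ⟨C, hC⟩ := h0.ae_eq_const
  exact ⟨C, hC.mono fun x hx => by simp only at hx; linarith⟩

theorem MemH.memLp {k : ℕ} {f : ℝ → ℝ} (h : MemH k f) : MemLp f 2 volume := by
  cases k with
  | zero => exact h
  | succ k => exact h.1

theorem MemH.congr {k : ℕ} {f f' : ℝ → ℝ} (h : MemH k f) (hf : f =ᵐ[volume] f') : MemH k f' := by
  cases k with
  | zero => exact (memLp_congr_ae hf).1 h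
  | succ k =>
    obtain ⟨h1, g, hg, hk⟩ := h
    exact ⟨(memLp_congr_ae hf).1 h1, g, hg.congr hf Filter.EventuallyEq.rfl, hk⟩

theorem MemH.exists_continuous {k : ℕ} {f : ℝ → ℝ} (h : MemH (k + 1) f) :
    ∃ F : ℝ → ℝ, f =ᵐ[volume] F ∧ Continuous F ∧ MemH (k + 1) F := by
  obtain ⟨g, hg, -⟩ := h.2
  obtain ⟨C, hC⟩ := hg.ae_eq_primitive
  refine ⟨_, hC, continuous_const.add (intervalIntegral.continuous_primitive
    hg.2.1.intervalIntegrable' 0), h.congr hC⟩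

/-- The weak derivative has a continuous representative, and its primitive is C¹. The regularity of
`F'` is kept so that the argument can be iterated. -/
theorem MemH.exists_hasDerivAt {k : ℕ} {f : ℝ → ℝ} (h : MemH (k + 2) f) :
    ∃ F F' : ℝ → ℝ, f =ᵐ[volume] F ∧ (∀ x, HasDerivAt F (F' x) x) ∧ Continuous F' ∧
      MemLp F 2 volume ∧ MemH (k + 1) F' := by
  obtain ⟨h0, g, hg, hk⟩ := h
  obtain ⟨F', hF', hc, hm⟩ := MemH.exists_continuous hk
  obtain ⟨C, hC⟩ := (hg.congr Filter.EventuallyEq.rfl hF').ae_eq_primitive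
  refine ⟨_, F', hC, fun x => ?_, hc, (memLp_congr_ae hC).1 h0, hm⟩
  exact (intervalIntegral.integral_hasDerivAt_right (hc.intervalIntegrable _ _)
      (hc.stronglyMeasurableAtFilter _ _) hc.continuousAt).const_add C

/-- A continuous function in `H^{k+2}` is continuously differentiable. -/
theorem MemH.exists_hasDerivAt_of_continuous {k : ℕ} {F : ℝ → ℝ} (h : MemH (k + 2) F)
    (hF : Continuous F) : ∃ F' : ℝ → ℝ, (∀ x, HasDerivAt F (F' x) x) ∧ Continuous F' ∧
      MemH (k + 1) F' := by
  obtain ⟨F₁, F', h1, h2, h3, -, h4⟩ := h.exists_hasDerivAt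
  have : F = F₁ := (Continuous.ae_eq_iff_eq volume hF
    (continuous_iff_continuousAt.2 fun x => (h2 x).continuousAt)).1 h1
  exact ⟨F', this ▸ h2, h3, h4⟩

end DarkSoliton

/-! ### The soliton profile: algebra, bounds and dependence on the speed -/

namespace DarkSoliton

open MeasureTheory Set

noncomputable section

/-- The exponential decay rate `√(2 - c²)` of the soliton `Q_c`. -/
def rate (c : ℝ) : ℝ := Real.sqrt (2 - c ^ 2)

/-- `τ_c = -∂ₓη_c / η_c`. -/
def tau (c x : ℝ) : ℝ := rate c * Real.tanh (rate c / 2 * x)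

/-- `∂_c η_c`. -/
def etaC (c x : ℝ) : ℝ := eta c x * (-(2 * c) + c * x * tau c x) / (2 - c ^ 2)

/-- `∂_c v_c`. -/
def velC (c x : ℝ) : ℝ := eta c x / (2 * (1 - eta c x)) + c * etaC c x / (2 * (1 - eta c x) ^ 2)

end

variable {c : ℝ}

theorem rate_pos (h2 : c ^ 2 < 2) : 0 < rate c := Real.sqrt_pos.2 (by linarith)

theorem rate_sq (h2 : c ^ 2 < 2) : rate c ^ 2 = 2 - c ^ 2 := Real.sq_sqrt (by linarith)

theorem rate_lt_sqrt_two (h0 : 0 < c ^ 2) : rate c < Real.sqrt 2 :=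
  (Real.sqrt_lt_sqrt_iff_of_pos (by norm_num)).2 (by linarith)

theorem eta_pos (h2 : c ^ 2 < 2) (x : ℝ) : 0 < eta c x := by
  unfold eta
  have := Real.cosh_pos (Real.sqrt (2 - c ^ 2) / 2 * x)
  have : 0 < 2 - c ^ 2 := by linarith
  positivity

/-- This is cosh² - sinh² = 1. It eliminates η in favour of τ and, since τ² ≥ 0, yields the upper
bound on η. -/
theorem tau_sq (h2 : c ^ 2 < 2) (x : ℝ) : tau c x ^ 2 = 2 - c ^ 2 - 2 * eta c x := by
  have hch := Real.cosh_pos (rate c / 2 * x)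
  have h := Real.cosh_sq (rate c / 2 * x)
  rw [tau, mul_pow, rate_sq h2, Real.tanh_eq_sinh_div_cosh, eta]
  change _ = 2 - c ^ 2 - 2 * ((2 - c ^ 2) / (2 * Real.cosh (rate c / 2 * x) ^ 2))
  generalize rate c / 2 * x = y at *
  field_simp
  linear_combination (-(2 - c ^ 2)) * h

theorem two_mul_eta_le (h2 : c ^ 2 < 2) (x : ℝ) : 2 * eta c x ≤ 2 - c ^ 2 := by
  have := tau_sq h2 x
  nlinarith [sq_nonneg (tau c x)]

theorem one_sub_eta_pos (h0 : 0 < c ^ 2) (h2 : c ^ 2 < 2) (x : ℝ) : 0 < 1 - eta c x := by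
  linarith [two_mul_eta_le h2 x]

theorem abs_tau_le (h2 : c ^ 2 < 2) (x : ℝ) : |tau c x| ≤ rate c := by
  refine abs_le_of_sq_le_sq ?_ (rate_pos h2).le
  rw [tau_sq h2, rate_sq h2]
  linarith [eta_pos h2 x]

theorem hasDerivAt_tau (h2 : c ^ 2 < 2) (x : ℝ) : HasDerivAt (tau c) (eta c x) x := by
  have hch := Real.cosh_pos (rate c / 2 * x)
  have h := Real.cosh_sq (rate c / 2 * x)
  have hlin : HasDerivAt (fun y => rate c / 2 * y) (rate c / 2) x := by
    simpa using (hasDerivAt_id x).const_mul (rate c / 2)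
  have key := ((hlin.sinh).div (hlin.cosh) hch.ne').const_mul (rate c)
  have hfun : tau c = fun y => rate c *
      ((fun y => Real.sinh (rate c / 2 * y)) / fun y => Real.cosh (rate c / 2 * y)) y := by
    funext y
    simp [tau, Real.tanh_eq_sinh_div_cosh]
  rw [hfun]
  refine key.congr_deriv ?_
  rw [eta]
  change _ = (2 - c ^ 2) / (2 * Real.cosh (rate c / 2 * x) ^ 2)
  rw [← rate_sq h2]
  clear key hlin hfun
  generalize rate c / 2 * x = y at *
  field_simp
  linear_combination rate c ^ 2 * h

theorem eta_eq_tau_sq (h2 : c ^ 2 < 2) (x : ℝ) : eta c x = (2 - c ^ 2 - tau c x ^ 2) / 2 := by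
  rw [tau_sq h2]; ring

theorem hasDerivAt_eta (h2 : c ^ 2 < 2) (x : ℝ) :
    HasDerivAt (eta c) (-(tau c x * eta c x)) x := by
  rw [show eta c = fun y => (2 - c ^ 2 - tau c y ^ 2) / 2 from funext (eta_eq_tau_sq h2)]
  refine ((((hasDerivAt_tau h2 x).pow 2).const_sub (2 - c ^ 2)).div_const 2).congr_deriv ?_
  simp only [← eta_eq_tau_sq h2]
  norm_num
  ring

theorem etaX_eq (h2 : c ^ 2 < 2) : etaX c = fun x => -(tau c x * eta c x) :=
  funext fun x => (hasDerivAt_eta h2 x).deriv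

theorem etaXX_eq (h2 : c ^ 2 < 2) (x : ℝ) :
    etaXX c x = (2 - c ^ 2) * eta c x - 3 * eta c x ^ 2 := by
  rw [etaXX, etaX_eq h2]
  refine (((hasDerivAt_tau h2 x).mul (hasDerivAt_eta h2 x)).neg).deriv.trans ?_
  linear_combination eta c x * tau_sq h2 x

theorem mu_eq (h2 : c ^ 2 < 2) (x : ℝ) : mu c x = eta c x * (3 - c ^ 2 - 3 * eta c x) := by
  rw [mu, etaXX_eq h2]; ring

/-- μ itself decays like η, but the quotient μ/η stays above c²/2. For c ≠ 0 this makes all the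
coefficients of the form bounded after cancelling η. -/
theorem denom_lower (h2 : c ^ 2 < 2) (x : ℝ) : c ^ 2 / 2 ≤ 3 - c ^ 2 - 3 * eta c x := by
  linarith [two_mul_eta_le h2 x]

theorem denom_upper (h2 : c ^ 2 < 2) (x : ℝ) : 3 - c ^ 2 - 3 * eta c x ≤ 3 := by
  nlinarith [eta_pos h2 x, sq_nonneg c]

theorem denom_pos (h0 : 0 < c ^ 2) (h2 : c ^ 2 < 2) (x : ℝ) : 0 < 3 - c ^ 2 - 3 * eta c x := by
  linarith [denom_lower h2 x]

theorem continuous_tau (h2 : c ^ 2 < 2) : Continuous (tau c) :=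
  continuous_iff_continuousAt.2 fun x => (hasDerivAt_tau h2 x).continuousAt

theorem continuous_eta (h2 : c ^ 2 < 2) : Continuous (eta c) :=
  continuous_iff_continuousAt.2 fun x => (hasDerivAt_eta h2 x).continuousAt

theorem exp_abs_div_four_le_cosh_sq (y : ℝ) : Real.exp (2 * |y|) / 4 ≤ Real.cosh y ^ 2 := by
  rw [← Real.cosh_abs, Real.cosh_eq, two_mul, Real.exp_add]
  nlinarith [Real.exp_pos (|y|), Real.exp_pos (-|y|)]

theorem cosh_sq_le_exp_abs (y : ℝ) : Real.cosh y ^ 2 ≤ Real.exp (2 * |y|) := by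
  rw [← Real.cosh_abs, Real.cosh_eq, two_mul, Real.exp_add]
  have : Real.exp (-|y|) ≤ Real.exp |y| := Real.exp_le_exp.2 (by linarith [abs_nonneg y])
  nlinarith [Real.exp_pos (|y|), Real.exp_pos (-|y|)]

theorem two_mul_abs_rate (h2 : c ^ 2 < 2) (x : ℝ) : 2 * |rate c / 2 * x| = rate c * |x| := by
  rw [abs_mul, abs_of_pos (half_pos (rate_pos h2))]; ring

theorem eta_le_exp (h2 : c ^ 2 < 2) (x : ℝ) :
    eta c x ≤ 2 * (2 - c ^ 2) * Real.exp (-(rate c * |x|)) := by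
  have h := exp_abs_div_four_le_cosh_sq (rate c / 2 * x)
  rw [two_mul_abs_rate h2] at h
  have hch := Real.cosh_pos (rate c / 2 * x)
  rw [eta]
  change (2 - c ^ 2) / (2 * Real.cosh (rate c / 2 * x) ^ 2) ≤ _
  rw [Real.exp_neg, div_le_iff₀ (by positivity)]
  have he := Real.exp_pos (rate c * |x|)
  have : 1 ≤ 4 * (Real.exp (rate c * |x|))⁻¹ * Real.cosh (rate c / 2 * x) ^ 2 := by
    rw [mul_comm 4, mul_assoc, ← div_eq_inv_mul, le_div_iff₀ he]
    linarith
  nlinarith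

theorem le_eta_exp (h2 : c ^ 2 < 2) (x : ℝ) :
    (2 - c ^ 2) / 2 * Real.exp (-(rate c * |x|)) ≤ eta c x := by
  have h := cosh_sq_le_exp_abs (rate c / 2 * x)
  rw [two_mul_abs_rate h2] at h
  have hch := Real.cosh_pos (rate c / 2 * x)
  rw [eta]
  change _ ≤ (2 - c ^ 2) / (2 * Real.cosh (rate c / 2 * x) ^ 2)
  rw [Real.exp_neg, ← div_eq_mul_inv, div_div]
  exact div_le_div_of_nonneg_left (by linarith) (by positivity) (by linarith)

/-- `η_c` is even and nonincreasing in `|x|`. -/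
theorem eta_le_eta_of_abs_le (h2 : c ^ 2 < 2) {x y : ℝ} (h : |y| ≤ |x|) :
    eta c x ≤ eta c y := by
  have hch := Real.cosh_pos (rate c / 2 * y)
  have hle : Real.cosh (rate c / 2 * y) ≤ Real.cosh (rate c / 2 * x) := by
    rw [Real.cosh_le_cosh, abs_mul, abs_mul]
    exact mul_le_mul_of_nonneg_left h (abs_nonneg _)
  change (2 - c ^ 2) / (2 * Real.cosh (rate c / 2 * x) ^ 2) ≤
    (2 - c ^ 2) / (2 * Real.cosh (rate c / 2 * y) ^ 2)
  exact div_le_div_of_nonneg_left (by linarith) (by positivity)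
    (mul_le_mul_of_nonneg_left (pow_le_pow_left₀ hch.le hle 2) (by norm_num))

theorem hasDerivAt_eta_speed (h2 : c ^ 2 < 2) (x : ℝ) :
    HasDerivAt (fun s => eta s x) (etaC c x) c := by
  have hκ : 0 < 2 - c ^ 2 := by linarith
  have ha := rate_pos h2
  have hch := Real.cosh_pos (rate c / 2 * x)
  have h1 : HasDerivAt (fun s : ℝ => 2 - s ^ 2) (-(2 * c)) c := by
    simpa using (hasDerivAt_pow 2 c).const_sub 2
  have h3 : HasDerivAt (fun s => Real.sqrt (2 - s ^ 2) / 2 * x) (-(2 * c) / (2 * rate c) / 2 * x) c :=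
    ((h1.sqrt hκ.ne').div_const 2).mul_const x
  have h4 := h1.div ((h3.cosh.pow 2).const_mul 2) (by
    simp only [Pi.pow_apply]
    have := Real.cosh_pos (Real.sqrt (2 - c ^ 2) / 2 * x)
    positivity)
  refine h4.congr_deriv ?_
  have he : eta c x = (2 - c ^ 2) / (2 * Real.cosh (rate c / 2 * x) ^ 2) := rfl
  rw [etaC, he, tau, Real.tanh_eq_sinh_div_cosh]
  simp only [Pi.pow_apply]
  rw [show Real.sqrt (2 - c ^ 2) = rate c from rfl, ← rate_sq h2]
  clear h4 he
  generalize rate c / 2 * x = y at *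
  field_simp
  ring

theorem hasDerivAt_vel_speed (h0 : 0 < c ^ 2) (h2 : c ^ 2 < 2) (x : ℝ) :
    HasDerivAt (fun s => vel s x) (velC c x) c := by
  have hk := one_sub_eta_pos h0 h2 x
  have h := hasDerivAt_eta_speed h2 x
  refine (((hasDerivAt_id c).mul h).div ((h.const_sub 1).const_mul 2)
    (by positivity)).congr_deriv ?_
  rw [velC]
  simp only [id, Pi.mul_apply]
  field_simp
  ring

theorem dcQ_eq (h0 : 0 < c ^ 2) (h2 : c ^ 2 < 2) : dcQ c = (etaC c, velC c) := by
  unfold dcQ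
  rw [funext fun x => (hasDerivAt_eta_speed h2 x).deriv,
    funext fun x => (hasDerivAt_vel_speed h0 h2 x).deriv]

end DarkSoliton

/-! ### Bounded multipliers and the conservation law behind the identity for G -/

namespace DarkSoliton

open MeasureTheory Set

/-- Bounded continuous real functions on `ℝ`. -/
def IsBddCont (f : ℝ → ℝ) : Prop := Continuous f ∧ ∃ C, ∀ x, |f x| ≤ C

theorem IsBddCont.const (r : ℝ) : IsBddCont fun _ => r := ⟨continuous_const, |r|, fun _ => le_rfl⟩

theorem IsBddCont.mul {f g : ℝ → ℝ} (hf : IsBddCont f) (hg : IsBddCont g) :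
    IsBddCont fun x => f x * g x := by
  obtain ⟨C, hC⟩ := hf.2
  obtain ⟨D, hD⟩ := hg.2
  refine ⟨hf.1.mul hg.1, C * D, fun x => ?_⟩
  rw [abs_mul]
  exact mul_le_mul (hC x) (hD x) (abs_nonneg _) ((abs_nonneg _).trans (hC x))

theorem IsBddCont.add {f g : ℝ → ℝ} (hf : IsBddCont f) (hg : IsBddCont g) :
    IsBddCont fun x => f x + g x := by
  obtain ⟨C, hC⟩ := hf.2
  obtain ⟨D, hD⟩ := hg.2
  exact ⟨hf.1.add hg.1, C + D, fun x => (abs_add_le _ _).trans (add_le_add (hC x) (hD x))⟩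

theorem IsBddCont.neg {f : ℝ → ℝ} (hf : IsBddCont f) : IsBddCont fun x => -f x := by
  obtain ⟨C, hC⟩ := hf.2
  exact ⟨hf.1.neg, C, fun x => by rw [abs_neg]; exact hC x⟩

theorem IsBddCont.sub {f g : ℝ → ℝ} (hf : IsBddCont f) (hg : IsBddCont g) :
    IsBddCont fun x => f x - g x := by
  simpa only [sub_eq_add_neg] using hf.add hg.neg

theorem IsBddCont.inv {f : ℝ → ℝ} (hf : IsBddCont f) {δ : ℝ} (hδ : 0 < δ) (h : ∀ x, δ ≤ f x) :
    IsBddCont fun x => (f x)⁻¹ := by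
  have hpos : ∀ x, 0 < f x := fun x => hδ.trans_le (h x)
  refine ⟨hf.1.inv₀ fun x => (hpos x).ne', δ⁻¹, fun x => ?_⟩
  rw [abs_of_pos (inv_pos.2 (hpos x))]
  exact inv_anti₀ hδ (h x)

theorem IsBddCont.memLp_mul {f g : ℝ → ℝ} (hf : IsBddCont f) (hg : MemLp g 2 volume) :
    MemLp (fun x => f x * g x) 2 volume := by
  obtain ⟨C, hC⟩ := hf.2
  refine hg.of_le_mul (c := C) (hf.1.aestronglyMeasurable.mul hg.1)
    (Filter.Eventually.of_forall fun x => ?_)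
  rw [norm_mul]
  exact mul_le_mul_of_nonneg_right (hC x) (norm_nonneg _)

theorem integrable_mul_of_memLp {f g : ℝ → ℝ} (hf : MemLp f 2 volume) (hg : MemLp g 2 volume) :
    Integrable fun x => f x * g x := hf.integrable_mul hg

theorem IsBddCont.integrable_mul_mul {b f g : ℝ → ℝ} (hb : IsBddCont b) (hf : MemLp f 2 volume)
    (hg : MemLp g 2 volume) : Integrable fun x => b x * (f x * g x) := by
  simpa only [mul_assoc] using integrable_mul_of_memLp (hb.memLp_mul hf) hg

theorem IsBddCont.integrable_mul_sq {b f : ℝ → ℝ} (hb : IsBddCont b) (hf : MemLp f 2 volume) :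
    Integrable fun x => b x * f x ^ 2 := by
  simpa only [sq] using hb.integrable_mul_mul hf hf

variable {c : ℝ}

theorem isBddCont_tau (h2 : c ^ 2 < 2) : IsBddCont (tau c) :=
  ⟨continuous_tau h2, rate c, abs_tau_le h2⟩

theorem isBddCont_eta (h2 : c ^ 2 < 2) : IsBddCont (eta c) :=
  ⟨continuous_eta h2, (2 - c ^ 2) / 2, fun x => by
    rw [abs_of_pos (eta_pos h2 x)]; linarith [two_mul_eta_le h2 x]⟩

theorem isBddCont_one_sub_eta (h2 : c ^ 2 < 2) : IsBddCont fun x => 1 - eta c x :=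
  (IsBddCont.const 1).sub (isBddCont_eta h2)

theorem isBddCont_inv_one_sub_eta (h0 : 0 < c ^ 2) (h2 : c ^ 2 < 2) :
    IsBddCont fun x => (1 - eta c x)⁻¹ :=
  (isBddCont_one_sub_eta h2).inv (half_pos h0) fun x => by linarith [two_mul_eta_le h2 x]

theorem isBddCont_inv_denom (h0 : 0 < c ^ 2) (h2 : c ^ 2 < 2) :
    IsBddCont fun x => (3 - c ^ 2 - 3 * eta c x)⁻¹ :=
  ((IsBddCont.const (3 - c ^ 2)).sub ((IsBddCont.const 3).mul (isBddCont_eta h2))).inv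
    (half_pos h0) (denom_lower h2)

theorem isBddCont_mu (h2 : c ^ 2 < 2) : IsBddCont (mu c) := by
  rw [funext (mu_eq h2)]
  exact (isBddCont_eta h2).mul
    ((IsBddCont.const (3 - c ^ 2)).sub ((IsBddCont.const 3).mul (isBddCont_eta h2)))

/-- `u₂ - c η / (2 μ) u₁ - c η' / (2 (1 - η) μ) u₁'`, where `p`, `p₁`, `q` stand for
`u₁`, `u₁'`, `u₂`. -/
noncomputable def resid (c : ℝ) (p p₁ q : ℝ → ℝ) (x : ℝ) : ℝ :=
  q x - c / (2 * (3 - c ^ 2 - 3 * eta c x)) * p x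
    + c * tau c x / (2 * (1 - eta c x) * (3 - c ^ 2 - 3 * eta c x)) * p₁ x

/-- `u₁' - (η' / η) u₁`. -/
noncomputable def slope (c : ℝ) (p p₁ : ℝ → ℝ) (x : ℝ) : ℝ := p₁ x + tau c x * p x

/-- Cancelling the factor η in μ = η(3 - c² - 3η) leaves only bounded coefficients, so L² membership
alone gives integrability. -/
theorem G_eq (h2 : c ^ 2 < 2) (h0 : 0 < c ^ 2) {u : Pair} {p p₁ q : ℝ → ℝ}
    (hp : u.1 =ᵐ[volume] p) (hp₁ : weakDeriv u.1 =ᵐ[volume] p₁) (hq : u.2 =ᵐ[volume] q) :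
    G c u = 2 * (∫ x, mu c x * resid c p p₁ q x ^ 2)
      + 3 / 2 * ∫ x, eta c x / (3 - c ^ 2 - 3 * eta c x) * slope c p p₁ x ^ 2 := by
  unfold G
  congr 2
  · refine integral_congr_ae ?_
    filter_upwards [hp, hp₁, hq] with x h1 h3 h4
    have hη := eta_pos h2 x
    have hk := one_sub_eta_pos h0 h2 x
    have hn := denom_pos h0 h2 x
    rw [h1, h3, h4, resid, etaX_eq h2]
    simp only [mu_eq h2]
    congr 2
    field_simp
    ring
  · refine integral_congr_ae ?_
    filter_upwards [hp, hp₁] with x h1 h3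
    have hη := eta_pos h2 x
    have hn := denom_pos h0 h2 x
    rw [h1, h3, slope, etaX_eq h2]
    simp only [mu_eq h2]
    have e1 : eta c x ^ 2 / (eta c x * (3 - c ^ 2 - 3 * eta c x)) =
        eta c x / (3 - c ^ 2 - 3 * eta c x) := by field_simp
    have e2 : -(tau c x * eta c x) / eta c x = -tau c x := by field_simp
    rw [e1, e2]
    ring

theorem memLp_resid (h2 : c ^ 2 < 2) (h0 : 0 < c ^ 2) {p p₁ q : ℝ → ℝ} (hp : MemLp p 2 volume)
    (hp₁ : MemLp p₁ 2 volume) (hq : MemLp q 2 volume) : MemLp (resid c p p₁ q) 2 volume := by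
  have hn := isBddCont_inv_denom h0 h2
  have h := (hq.sub (((IsBddCont.const (c / 2)).mul hn).memLp_mul hp)).add
    ((((IsBddCont.const (c / 2)).mul (isBddCont_tau h2)).mul
      ((isBddCont_inv_one_sub_eta h0 h2).mul hn)).memLp_mul hp₁)
  convert h using 1
  funext x
  have hk := one_sub_eta_pos h0 h2 x
  have hn := denom_pos h0 h2 x
  simp only [resid, Pi.add_apply, Pi.sub_apply]
  field_simp

theorem memLp_slope (h2 : c ^ 2 < 2) {p p₁ : ℝ → ℝ} (hp : MemLp p 2 volume)
    (hp₁ : MemLp p₁ 2 volume) : MemLp (slope c p p₁) 2 volume :=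
  hp₁.add ((isBddCont_tau h2).memLp_mul hp)

theorem integrable_mu_resid (h2 : c ^ 2 < 2) (h0 : 0 < c ^ 2) {p p₁ q : ℝ → ℝ}
    (hp : MemLp p 2 volume) (hp₁ : MemLp p₁ 2 volume) (hq : MemLp q 2 volume) :
    Integrable fun x => mu c x * resid c p p₁ q x ^ 2 :=
  (isBddCont_mu h2).integrable_mul_sq (memLp_resid h2 h0 hp hp₁ hq)

theorem integrable_slope (h2 : c ^ 2 < 2) (h0 : 0 < c ^ 2) {p p₁ : ℝ → ℝ} (hp : MemLp p 2 volume)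
    (hp₁ : MemLp p₁ 2 volume) :
    Integrable fun x => eta c x / (3 - c ^ 2 - 3 * eta c x) * slope c p p₁ x ^ 2 := by
  simpa only [div_eq_mul_inv] using
    ((isBddCont_eta h2).mul (isBddCont_inv_denom h0 h2)).integrable_mul_sq (memLp_slope h2 hp hp₁)

/-- First component of `H_c (J S u)` for smooth `u`. -/
noncomputable def hamFst (c : ℝ) (p₁ p₂ p₃ q₁ : ℝ → ℝ) (x : ℝ) : ℝ :=
  1 / 2 * (p₃ x * (1 - eta c x)⁻¹ - tau c x * eta c x * (1 - eta c x)⁻¹ ^ 2 * p₂ x)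
    - 1 / 2 * (2 - ((2 - c ^ 2) * eta c x - 3 * eta c x ^ 2) * (1 - eta c x)⁻¹ ^ 2
      - (tau c x * eta c x) ^ 2 * (1 - eta c x)⁻¹ ^ 3) * p₁ x
    + c * (1 - eta c x)⁻¹ * q₁ x

/-- Second component of `H_c (J S u)` for smooth `u`. -/
noncomputable def hamSnd (c : ℝ) (p₁ q₁ : ℝ → ℝ) (x : ℝ) : ℝ :=
  c * (1 - eta c x)⁻¹ * p₁ x - 2 * (1 - eta c x) * q₁ x

/-- The flux in the conservation law that relates the densities of the two quadratic forms. -/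
noncomputable def flux (c : ℝ) (p p₁ p₂ q : ℝ → ℝ) (x : ℝ) : ℝ :=
  tau c x * (1 - eta c x)⁻¹ * (p x * p₂ x) - 1 / 2 * (tau c x * (1 - eta c x)⁻¹) * (p₁ x * p₁ x)
    - eta c x * (1 - eta c x)⁻¹ * (p x * p₁ x) - tau c x * (p x * p x)
    + 2 * c * tau c x * (p x * q x) - 2 * (tau c x * (1 - eta c x)) * (q x * q x)

theorem hasDerivAt_inv_one_sub_eta (h0 : 0 < c ^ 2) (h2 : c ^ 2 < 2) (x : ℝ) :
    HasDerivAt (fun y => (1 - eta c y)⁻¹) (-(tau c x * eta c x * (1 - eta c x)⁻¹ ^ 2)) x := by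
  have hk := one_sub_eta_pos h0 h2 x
  refine (((hasDerivAt_eta h2 x).const_sub 1).inv hk.ne').congr_deriv ?_
  field_simp

theorem hasDerivAt_flux (h0 : 0 < c ^ 2) (h2 : c ^ 2 < 2) {p p₁ p₂ p₃ q q₁ : ℝ → ℝ} {x : ℝ}
    (hp : HasDerivAt p (p₁ x) x) (hp₁ : HasDerivAt p₁ (p₂ x) x) (hp₂ : HasDerivAt p₂ (p₃ x) x)
    (hq : HasDerivAt q (q₁ x) x) :
    HasDerivAt (flux c p p₁ p₂ q)
      (2 * (tau c x * p x * hamFst c p₁ p₂ p₃ q₁ x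
          + (c / 2 * (tau c x * eta c x) * (1 - eta c x)⁻¹ ^ 2 * p x + tau c x * q x)
            * hamSnd c p₁ q₁ x)
        - (2 * (mu c x * resid c p p₁ q x ^ 2)
          + 3 / 2 * (eta c x / (3 - c ^ 2 - 3 * eta c x) * slope c p p₁ x ^ 2))) x := by
  have hk := one_sub_eta_pos h0 h2 x
  have hn := denom_pos h0 h2 x
  have hη := eta_eq_tau_sq h2 x
  have dη := hasDerivAt_eta h2 x
  have dτ := hasDerivAt_tau h2 x
  have dι := hasDerivAt_inv_one_sub_eta h0 h2 x
  have key := ((((((dτ.mul dι).mul (hp.mul hp₂)).sub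
    (((dτ.mul dι).const_mul (1 / 2)).mul (hp₁.mul hp₁))).sub
    ((dη.mul dι).mul (hp.mul hp₁))).sub (dτ.mul (hp.mul hp))).add
    ((dτ.const_mul (2 * c)).mul (hp.mul hq))).sub
    (((dτ.mul (dη.const_sub 1)).const_mul 2).mul (hq.mul hq))
  refine HasDerivAt.congr_deriv (f := flux c p p₁ p₂ q) key ?_
  simp only [mu_eq h2, resid, slope, hamFst, hamSnd, Pi.mul_apply]
  clear key dη dτ dι hp hp₁ hp₂ hq
  generalize eta c x = η at *
  generalize tau c x = τ at *
  generalize p x = a, p₁ x = a₁, p₂ x = a₂, p₃ x = a₃, q x = b, q₁ x = b₁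
  -- With η expressed through τ, the two denominators become (c² + τ²)/2 and (c² + 3τ²)/2. What
  -- remains is a rational identity in c, τ and the values of the functions and their derivatives.
  subst hη
  have e1 : 1 - (2 - c ^ 2 - τ ^ 2) / 2 = (c ^ 2 + τ ^ 2) / 2 := by ring
  have e2 : 3 - c ^ 2 - 3 * ((2 - c ^ 2 - τ ^ 2) / 2) = (c ^ 2 + 3 * τ ^ 2) / 2 := by ring
  rw [e1] at hk ⊢
  rw [e2] at hn ⊢
  have hk' : c ^ 2 + τ ^ 2 ≠ 0 := by intro h; rw [h] at hk; simp at hk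
  have hn' : c ^ 2 + 3 * τ ^ 2 ≠ 0 := by intro h; rw [h] at hn; simp at hn
  field_simp
  ring

/-- Both the flux and its derivative are sums of bounded multiples of products of two L² functions.
Hence both are integrable and the derivative integrates to zero. -/
theorem integral_ham_eq (h0 : 0 < c ^ 2) (h2 : c ^ 2 < 2) {p p₁ p₂ p₃ q q₁ : ℝ → ℝ}
    (dp : ∀ x, HasDerivAt p (p₁ x) x) (dp₁ : ∀ x, HasDerivAt p₁ (p₂ x) x)
    (dp₂ : ∀ x, HasDerivAt p₂ (p₃ x) x) (dq : ∀ x, HasDerivAt q (q₁ x) x)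
    (hp : MemLp p 2 volume) (hp₁ : MemLp p₁ 2 volume) (hp₂ : MemLp p₂ 2 volume)
    (hp₃ : MemLp p₃ 2 volume) (hq : MemLp q 2 volume) (hq₁ : MemLp q₁ 2 volume) :
    2 * (∫ x, mu c x * resid c p p₁ q x ^ 2)
      + 3 / 2 * (∫ x, eta c x / (3 - c ^ 2 - 3 * eta c x) * slope c p p₁ x ^ 2) =
    2 * ∫ x, (tau c x * p x * hamFst c p₁ p₂ p₃ q₁ x
          + (c / 2 * (tau c x * eta c x) * (1 - eta c x)⁻¹ ^ 2 * p x + tau c x * q x)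
            * hamSnd c p₁ q₁ x) := by
  have bη := isBddCont_eta h2
  have bτ := isBddCont_tau h2
  have bk := isBddCont_one_sub_eta h2
  have bι := isBddCont_inv_one_sub_eta h0 h2
  have bι2 : IsBddCont fun x => (1 - eta c x)⁻¹ ^ 2 := by simpa only [sq] using bι.mul bι
  have bι3 : IsBddCont fun x => (1 - eta c x)⁻¹ ^ 3 := by
    simpa only [pow_succ, pow_zero, one_mul] using (bι.mul bι).mul bι
  have bτη2 : IsBddCont fun x => (tau c x * eta c x) ^ 2 := by
    simpa only [sq] using (bτ.mul bη).mul (bτ.mul bη)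
  have bη2 : IsBddCont fun x => eta c x ^ 2 := by simpa only [sq] using bη.mul bη
  have hm1 : MemLp (hamFst c p₁ p₂ p₃ q₁) 2 volume := by
    have := (((((bι.memLp_mul hp₃).sub (((bτ.mul bη).mul bι2).memLp_mul hp₂)).const_mul (1 / 2)).sub
      (((IsBddCont.const (1 / 2)).mul (((IsBddCont.const 2).sub
        ((((IsBddCont.const (2 - c ^ 2)).mul bη).sub ((IsBddCont.const 3).mul bη2)).mul bι2)).sub
        (bτη2.mul bι3))).memLp_mul hp₁)).add
      (((IsBddCont.const c).mul bι).memLp_mul hq₁))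
    convert this using 1
    funext x
    simp only [hamFst, Pi.add_apply, Pi.sub_apply]
    ring
  have hm2 : MemLp (hamSnd c p₁ q₁) 2 volume :=
    (((IsBddCont.const c).mul bι).memLp_mul hp₁).sub
      (((IsBddCont.const 2).mul bk).memLp_mul hq₁)
  have hL := (integrable_mul_of_memLp (bτ.memLp_mul hp) hm1).add (integrable_mul_of_memLp
    (((((IsBddCont.const (c / 2)).mul (bτ.mul bη)).mul bι2).memLp_mul hp).add (bτ.memLp_mul hq)) hm2)
  simp only [Pi.add_apply] at hL
  have hA := integrable_mu_resid h2 h0 hp hp₁ hq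
  have hB := integrable_slope h2 h0 hp hp₁
  have hflux : Integrable (flux c p p₁ p₂ q) :=
    ((((((bτ.mul bι).integrable_mul_mul hp hp₂).sub
      (((IsBddCont.const (1 / 2)).mul (bτ.mul bι)).integrable_mul_mul hp₁ hp₁)).sub
      ((bη.mul bι).integrable_mul_mul hp hp₁)).sub (bτ.integrable_mul_mul hp hp)).add
      (((IsBddCont.const (2 * c)).mul bτ).integrable_mul_mul hp hq)).sub
      (((IsBddCont.const 2).mul (bτ.mul bk)).integrable_mul_mul hq hq)
  have hAB := (hA.const_mul 2).add (hB.const_mul (3 / 2))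
  have key := integral_eq_zero_of_hasDerivAt_of_integrable
    (fun x => hasDerivAt_flux h0 h2 (dp x) (dp₁ x) (dp₂ x) (dq x))
    ((hL.const_mul 2).sub hAB) hflux
  have e := integral_sub (hL.const_mul 2) hAB
  simp only [Pi.add_apply] at e
  rw [integral_const_mul] at e
  have e2 := integral_add (hA.const_mul 2) (hB.const_mul (3 / 2))
  rw [integral_const_mul, integral_const_mul] at e2
  rw [← e2]
  linarith

theorem G_eq_innerL2 (h0 : 0 < c ^ 2) (h2 : c ^ 2 < 2) {u : Pair} (hu : MemX 3 u) :
    G c u = 2 * innerL2 (opS (opM c u)) (opH c (opJ (opS u))) := by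
  obtain ⟨p, p₁, hp, dp, cp₁, mp, m3⟩ := MemH.exists_hasDerivAt hu.1
  obtain ⟨p₂, dp₁, cp₂, m2⟩ := m3.exists_hasDerivAt_of_continuous cp₁
  obtain ⟨p₃, dp₂, cp₃, m1⟩ := m2.exists_hasDerivAt_of_continuous cp₂
  obtain ⟨q, q₁, hq, dq, cq₁, mq, n2⟩ := MemH.exists_hasDerivAt hu.2
  have hp₁ := weakDeriv_ae_eq hp dp cp₁
  have hq₁ := weakDeriv_ae_eq hq dq cq₁
  -- Since S² = 1, JSu is -2∂ₓu.
  have hε : (opJ (opS u)).1 =ᵐ[volume] fun x => -2 * p₁ x :=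
    hp₁.mono fun x hx => by simp only [opJ, opS, hx]
  have hε' := weakDeriv_ae_eq hε (fun x => (dp₁ x).const_mul (-2)) (continuous_const.mul cp₂)
  have hw : (fun y => weakDeriv (opJ (opS u)).1 y / (1 - eta c y)) =ᵐ[volume]
      fun y => -2 * (p₂ y * (1 - eta c y)⁻¹) :=
    hε'.mono fun x hx => by simp only [hx]; ring
  have cι := (isBddCont_inv_one_sub_eta h0 h2).1
  have cη := continuous_eta h2
  have cτ := continuous_tau h2
  have hw' := weakDeriv_ae_eq hw
    (fun x => ((dp₂ x).mul (hasDerivAt_inv_one_sub_eta h0 h2 x)).const_mul (-2)) (by fun_prop)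
  rw [G_eq h2 h0 hp hp₁ hq, integral_ham_eq h0 h2 dp dp₁ dp₂ dq mp m3.memLp m2.memLp m1.memLp mq
    n2.memLp, innerL2]
  congr 1
  refine integral_congr_ae ?_
  filter_upwards [hp, hq, hp₁, hq₁, hw'] with x e1 e2 e3 e4 e5
  have hη := eta_pos h2 x
  have hk := one_sub_eta_pos h0 h2 x
  simp only [opH, e5]
  simp only [opS, opM, opJ, e1, e2, e3, e4, etaX_eq h2, etaXX_eq h2, vel, hamFst, hamSnd]
  field_simp
  ring

end DarkSoliton

/-! ### Exponential decay and the derivative of the momentum in the speed -/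

namespace DarkSoliton

open MeasureTheory Set Filter Topology

theorem integral_exp_neg_mul_abs {d : ℝ} (hd : 0 < d) :
    ∫ x : ℝ, Real.exp (-(d * |x|)) = 2 / d := by
  rw [integral_comp_abs (f := fun x => Real.exp (-(d * x)))]
  have h := integral_exp_mul_Ioi (neg_lt_zero.2 hd) 0
  simp only [neg_mul, mul_zero, Real.exp_zero] at h
  rw [h]
  field_simp

theorem integrable_exp_neg_mul_abs {d : ℝ} (hd : 0 < d) :
    Integrable fun x : ℝ => Real.exp (-(d * |x|)) := by
  -- A non-integrable function has integral 0 by convention, which contradicts the positive value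
  -- 2/d.
  by_contra h
  have := integral_undef h
  rw [integral_exp_neg_mul_abs hd] at this
  have : 0 < 2 / d := by positivity
  linarith

/-- The Cauchy–Schwarz inequality for real square-integrable functions. -/
theorem sq_integral_mul_le {α : Type*} [MeasurableSpace α] {μ : Measure α} {f g : α → ℝ}
    (hf : MemLp f 2 μ) (hg : MemLp g 2 μ) :
    (∫ x, f x * g x ∂μ) ^ 2 ≤ (∫ x, f x ^ 2 ∂μ) * ∫ x, g x ^ 2 ∂μ := by
  have hff := hf.integrable_sq
  have hgg := hg.integrable_sq
  have hfg : Integrable (fun x => f x * g x) μ := hf.integrable_mul hg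
  have h : ∀ t : ℝ, 0 ≤ (∫ x, f x ^ 2 ∂μ) * (t * t) + (2 * ∫ x, f x * g x ∂μ) * t
      + ∫ x, g x ^ 2 ∂μ := by
    intro t
    have e : ∫ x, (t * f x + g x) ^ 2 ∂μ = (∫ x, f x ^ 2 ∂μ) * (t * t)
        + (2 * ∫ x, f x * g x ∂μ) * t + ∫ x, g x ^ 2 ∂μ := by
      have i1 := integral_add (hff.mul_const (t * t)) ((hfg.const_mul 2).mul_const t)
      have i2 := integral_add ((hff.mul_const (t * t)).add ((hfg.const_mul 2).mul_const t)) hgg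
      simp only [Pi.add_apply] at i2
      rw [← integral_mul_const, ← integral_const_mul, ← integral_mul_const, ← i1, ← i2]
      exact integral_congr_ae (Eventually.of_forall fun x => by ring)
    rw [← e]
    exact integral_nonneg fun x => sq_nonneg _
  have := discrim_le_zero h
  rw [discrim] at this
  linarith

theorem one_add_abs_le_exp {d : ℝ} (hd : 0 < d) (x : ℝ) :
    1 + |x| ≤ (1 + 1 / d) * Real.exp (d * |x|) := by
  have h1 : 1 ≤ Real.exp (d * |x|) := Real.one_le_exp (by positivity)
  have h2 : d * |x| ≤ Real.exp (d * |x|) := by linarith [Real.add_one_le_exp (d * |x|)]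
  have h3 : |x| ≤ 1 / d * Real.exp (d * |x|) := by
    rw [one_div, ← div_eq_inv_mul, le_div_iff₀ hd]; linarith
  linarith

theorem memLp_two_of_abs_le_exp {f : ℝ → ℝ} (hf : Continuous f) {C d : ℝ} (hd : 0 < d)
    (h : ∀ x, |f x| ≤ C * Real.exp (-(d * |x|))) : MemLp f 2 volume := by
  rw [memLp_two_iff_integrable_sq hf.aestronglyMeasurable]
  refine ((integrable_exp_neg_mul_abs (d := 2 * d) (by positivity)).const_mul (C ^ 2)).mono'
    (hf.pow 2).aestronglyMeasurable (Eventually.of_forall fun x => ?_)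
  rw [Real.norm_eq_abs, abs_of_nonneg (sq_nonneg _), ← sq_abs]
  refine (pow_le_pow_left₀ (abs_nonneg _) (h x) 2).trans (le_of_eq ?_)
  rw [mul_pow, ← Real.exp_nat_mul]
  congr 2
  push_cast
  ring

variable {c : ℝ}

theorem memLp_eta (h2 : c ^ 2 < 2) : MemLp (eta c) 2 volume :=
  memLp_two_of_abs_le_exp (continuous_eta h2) (rate_pos h2) fun x => by
    rw [abs_of_pos (eta_pos h2 x)]; exact eta_le_exp h2 x

theorem memLp_vel (h0 : 0 < c ^ 2) (h2 : c ^ 2 < 2) : MemLp (vel c) 2 volume := by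
  have hv : vel c = fun x => c / 2 * (1 - eta c x)⁻¹ * eta c x := by
    funext x
    have := one_sub_eta_pos h0 h2 x
    rw [vel]
    field_simp
  rw [hv]
  exact ((IsBddCont.const (c / 2)).mul (isBddCont_inv_one_sub_eta h0 h2)).memLp_mul (memLp_eta h2)

theorem abs_speed_lt (h2 : c ^ 2 < 2) : |c| < Real.sqrt 2 := by
  rw [← Real.sqrt_sq_eq_abs]; exact Real.sqrt_lt_sqrt (sq_nonneg _) h2

theorem sqrt_two_lt : Real.sqrt 2 < 3 / 2 := by
  rw [Real.sqrt_lt' (by norm_num)]; norm_num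

/-- `(1 + |x|) η_c` is square integrable. -/
theorem memLp_weight (h2 : c ^ 2 < 2) : MemLp (fun x => (1 + |x|) * eta c x) 2 volume := by
  have ha := rate_pos h2
  refine memLp_two_of_abs_le_exp ((continuous_const.add continuous_abs).mul (continuous_eta h2))
    (C := (1 + 1 / (rate c / 2)) * (2 * (2 - c ^ 2))) (d := rate c / 2) (by positivity) fun x => ?_
  rw [abs_of_nonneg (mul_nonneg (by positivity) (eta_pos h2 x).le)]
  refine (mul_le_mul (one_add_abs_le_exp (half_pos ha) x) (eta_le_exp h2 x) (eta_pos h2 x).le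
    (by positivity)).trans (le_of_eq ?_)
  rw [show (-(rate c / 2 * |x|)) = rate c / 2 * |x| + -(rate c * |x|) by ring, Real.exp_add]
  ring

/-- Differentiating the decay rate in c produces a factor x, hence the weight (1 + |x|)η. The
constant 4 comes from |c|, |τ| ≤ 3/2, which give 2|c| ≤ 3 and |c τ| ≤ 9/4. -/
theorem abs_etaC_le (h2 : c ^ 2 < 2) (x : ℝ) :
    |etaC c x| ≤ 4 / (2 - c ^ 2) * ((1 + |x|) * eta c x) := by
  have hκ : 0 < 2 - c ^ 2 := by linarith
  have hη := eta_pos h2 x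
  have hc : |c| ≤ 3 / 2 := (abs_speed_lt h2).le.trans sqrt_two_lt.le
  have hτ : |tau c x| ≤ 3 / 2 := (abs_tau_le h2 x).trans
    ((Real.sqrt_le_sqrt (by nlinarith [sq_nonneg c])).trans sqrt_two_lt.le)
  rw [etaC, abs_div, abs_mul, abs_of_pos hκ, abs_of_pos hη, div_mul_eq_mul_div]
  refine div_le_div_of_nonneg_right ?_ hκ.le
  have h1 : |-(2 * c) + c * x * tau c x| ≤ 2 * |c| + |c| * |x| * |tau c x| := by
    refine (abs_add_le _ _).trans (le_of_eq ?_)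
    rw [abs_neg, abs_mul, abs_mul, abs_mul, abs_two]
  have h3 : |c| * |x| * |tau c x| ≤ 3 / 2 * |x| * (3 / 2) := by gcongr
  have h4 : |-(2 * c) + c * x * tau c x| ≤ 4 * (1 + |x|) := by linarith [abs_nonneg x]
  nlinarith

theorem abs_velC_le (h0 : 0 < c ^ 2) (h2 : c ^ 2 < 2) (x : ℝ) :
    |velC c x| ≤ 20 / (c ^ 4 * (2 - c ^ 2)) * ((1 + |x|) * eta c x) := by
  have hκ : 0 < 2 - c ^ 2 := by linarith
  have hη := eta_pos h2 x
  have hc0 : c ≠ 0 := by rintro rfl; norm_num at h0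
  have hc : |c| ≤ 2 := (abs_speed_lt h2).le.trans (sqrt_two_lt.le.trans (by norm_num))
  have hk : c ^ 2 / 2 ≤ 1 - eta c x := by linarith [two_mul_eta_le h2 x]
  have hk0 := one_sub_eta_pos h0 h2 x
  have hw : eta c x ≤ (1 + |x|) * eta c x := by nlinarith [abs_nonneg x]
  have hw0 : 0 < (1 + |x|) * eta c x := hη.trans_le hw
  have h4 : c ^ 4 = (c ^ 2) ^ 2 := by ring
  rw [velC]
  refine (abs_add_le _ _).trans ?_
  have t1 : |eta c x / (2 * (1 - eta c x))| ≤ 1 / c ^ 2 * ((1 + |x|) * eta c x) := by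
    rw [abs_of_pos (by positivity), div_le_iff₀ (by positivity)]
    calc eta c x ≤ (1 + |x|) * eta c x := hw
      _ = 1 / c ^ 2 * ((1 + |x|) * eta c x) * (2 * (c ^ 2 / 2)) := by field_simp
      _ ≤ _ := by gcongr
  have t2 : |c * etaC c x / (2 * (1 - eta c x) ^ 2)| ≤
      16 / (c ^ 4 * (2 - c ^ 2)) * ((1 + |x|) * eta c x) := by
    rw [abs_div, abs_mul, abs_of_pos (show 0 < 2 * (1 - eta c x) ^ 2 by positivity),
      div_le_iff₀ (by positivity)]
    calc |c| * |etaC c x| ≤ 2 * (4 / (2 - c ^ 2) * ((1 + |x|) * eta c x)) := by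
          gcongr; exact abs_etaC_le h2 x
      _ = 16 / (c ^ 4 * (2 - c ^ 2)) * ((1 + |x|) * eta c x) * (2 * (c ^ 2 / 2) ^ 2) := by
          rw [h4]; field_simp; norm_num
      _ ≤ _ := by gcongr
  -- The first term is enlarged to the denominator of the second, using c²(2 - c²) ≤ 4; this gives
  -- 20 = 4 + 16.
  have t3 : 1 / c ^ 2 ≤ 4 / (c ^ 4 * (2 - c ^ 2)) := by
    rw [h4, div_le_div_iff₀ h0 (by positivity)]
    nlinarith
  have t4 := mul_le_mul_of_nonneg_right t3 hw0.le
  have t5 : 20 / (c ^ 4 * (2 - c ^ 2)) = 4 / (c ^ 4 * (2 - c ^ 2)) + 16 / (c ^ 4 * (2 - c ^ 2)) := by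
    rw [← add_div]; norm_num
  rw [t5, add_mul]
  linarith

theorem continuous_etaC (h2 : c ^ 2 < 2) : Continuous (etaC c) := by
  have := continuous_eta h2
  have := continuous_tau h2
  unfold etaC
  fun_prop

theorem continuous_velC (h0 : 0 < c ^ 2) (h2 : c ^ 2 < 2) : Continuous (velC c) := by
  have h1 := continuous_eta h2
  have h3 := continuous_etaC h2
  unfold velC
  refine (h1.div (by fun_prop) fun x => ?_).add ((continuous_const.mul h3).div (by fun_prop)
    fun x => ?_)
  · have := one_sub_eta_pos h0 h2 x; positivity
  · have := one_sub_eta_pos h0 h2 x; positivity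

theorem memLp_etaC (h2 : c ^ 2 < 2) : MemLp (etaC c) 2 volume :=
  (memLp_weight h2).of_le_mul (continuous_etaC h2).aestronglyMeasurable
    (Eventually.of_forall fun x => by
      rw [Real.norm_eq_abs, Real.norm_of_nonneg (mul_nonneg (by positivity) (eta_pos h2 x).le)]
      exact abs_etaC_le h2 x)

theorem memLp_velC (h0 : 0 < c ^ 2) (h2 : c ^ 2 < 2) : MemLp (velC c) 2 volume :=
  (memLp_weight h2).of_le_mul (continuous_velC h0 h2).aestronglyMeasurable
    (Eventually.of_forall fun x => by
      rw [Real.norm_eq_abs, Real.norm_of_nonneg (mul_nonneg (by positivity) (eta_pos h2 x).le)]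
      exact abs_velC_le h0 h2 x)

theorem tendsto_abs_mul_eta (h2 : c ^ 2 < 2) {l : Filter ℝ} (hl : Tendsto (fun x : ℝ => |x|) l atTop) :
    Tendsto (fun x => (1 + |x|) * eta c x) l (𝓝 0) := by
  have ha := rate_pos h2
  have h1 : Tendsto (fun x => (1 + 1 / (rate c / 2)) * (2 * (2 - c ^ 2)) *
      Real.exp (-(rate c / 2 * |x|))) l (𝓝 0) := by
    simpa only [mul_zero, Function.comp_apply] using (Real.tendsto_exp_neg_atTop_nhds_zero.comp
      (hl.const_mul_atTop (half_pos ha))).const_mul ((1 + 1 / (rate c / 2)) * (2 * (2 - c ^ 2)))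
  refine squeeze_zero (fun x => mul_nonneg (by positivity) (eta_pos h2 x).le) (fun x => ?_) h1
  refine (mul_le_mul (one_add_abs_le_exp (half_pos ha) x) (eta_le_exp h2 x) (eta_pos h2 x).le
    (by positivity)).trans (le_of_eq ?_)
  rw [show (-(rate c / 2 * |x|)) = rate c / 2 * |x| + -(rate c * |x|) by ring, Real.exp_add]
  ring

theorem tendsto_eta (h2 : c ^ 2 < 2) {l : Filter ℝ} (hl : Tendsto (fun x : ℝ => |x|) l atTop) :
    Tendsto (eta c) l (𝓝 0) :=
  squeeze_zero (fun x => (eta_pos h2 x).le)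
    (fun x => by nlinarith [abs_nonneg x, eta_pos h2 x]) (tendsto_abs_mul_eta h2 hl)

theorem tendsto_mul_eta (h2 : c ^ 2 < 2) {l : Filter ℝ} (hl : Tendsto (fun x : ℝ => |x|) l atTop) :
    Tendsto (fun x => x * eta c x) l (𝓝 0) :=
  squeeze_zero_norm (fun x => by
    rw [Real.norm_eq_abs, abs_mul, abs_of_pos (eta_pos h2 x)]
    nlinarith [abs_nonneg x, eta_pos h2 x]) (tendsto_abs_mul_eta h2 hl)

/-- From (√(2-c²) - τ)(√(2-c²) + τ) = 2η, the gap is at most 2η/√(2-c²) for x ≥ 0. -/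
theorem tendsto_tau_atTop (h2 : c ^ 2 < 2) : Tendsto (tau c) atTop (𝓝 (rate c)) := by
  have ha := rate_pos h2
  have h1 : Tendsto (fun x => rate c - 2 / rate c * eta c x) atTop (𝓝 (rate c)) := by
    simpa using ((tendsto_eta h2 tendsto_abs_atTop_atTop).const_mul (2 / rate c)).const_sub (rate c)
  refine tendsto_of_tendsto_of_tendsto_of_le_of_le' h1 tendsto_const_nhds ?_
    (Eventually.of_forall fun x => (le_abs_self _).trans (abs_tau_le h2 x))
  filter_upwards [eventually_ge_atTop 0] with x hx
  have hτ : 0 ≤ tau c x := by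
    rw [tau, Real.tanh_eq_sinh_div_cosh]
    exact mul_nonneg ha.le (div_nonneg (Real.sinh_nonneg_iff.2 (by positivity))
      (Real.cosh_pos _).le)
  have hτ' : tau c x ≤ rate c := (le_abs_self _).trans (abs_tau_le h2 x)
  have e := tau_sq h2 x
  rw [← rate_sq h2] at e
  rw [sub_le_comm, div_mul_eq_mul_div, le_div_iff₀ ha]
  nlinarith

theorem tendsto_tau_atBot (h2 : c ^ 2 < 2) : Tendsto (tau c) atBot (𝓝 (-rate c)) := by
  have h : tau c = fun x => -tau c (-x) := by
    funext x
    simp [tau]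
  rw [h]
  exact ((tendsto_tau_atTop h2).comp tendsto_neg_atBot_atTop).neg

/-- `∫ ∂_c(η_c v_c) = -2 √(2 - c²)`: the derivative of the momentum with respect to the speed. -/
theorem integral_eta_velC_add_vel_etaC (h0 : 0 < c ^ 2) (h2 : c ^ 2 < 2) :
    ∫ x, (eta c x * velC c x + vel c x * etaC c x) = -(2 * rate c) := by
  have hκ : 0 < 2 - c ^ 2 := by linarith
  -- An explicit antiderivative. Its first two terms vanish at ±∞ with η and xη; only -τ contributes
  -- to the difference of limits.
  let A : ℝ → ℝ := fun x => (-(c ^ 2 / (2 * (2 - c ^ 2)))) * ((x * eta c x) * (eta c x * (1 - eta c x)⁻¹))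
    - 1 / (2 - c ^ 2) * (tau c x * (eta c x * (1 - eta c x)⁻¹)) - tau c x
  have hd : ∀ x, HasDerivAt A (eta c x * velC c x + vel c x * etaC c x) x := by
    intro x
    have dη := hasDerivAt_eta h2 x
    have dτ := hasDerivAt_tau h2 x
    have dι := hasDerivAt_inv_one_sub_eta h0 h2 x
    have hk := one_sub_eta_pos h0 h2 x
    have hη := eta_eq_tau_sq h2 x
    refine HasDerivAt.congr_deriv (((((hasDerivAt_id x).mul dη).mul (dη.mul dι)).const_mul
      (-(c ^ 2 / (2 * (2 - c ^ 2))))).sub ((dτ.mul (dη.mul dι)).const_mul (1 / (2 - c ^ 2)))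
      |>.sub dτ) ?_
    simp only [velC, vel, etaC, Pi.mul_apply, id]
    clear dη dτ dι
    generalize eta c x = η at *
    generalize tau c x = τ at *
    subst hη
    have e1 : 1 - (2 - c ^ 2 - τ ^ 2) / 2 = (c ^ 2 + τ ^ 2) / 2 := by ring
    rw [e1] at hk ⊢
    have hk' : c ^ 2 + τ ^ 2 ≠ 0 := by intro h; rw [h] at hk; simp at hk
    field_simp
    ring
  have hlim : ∀ {l : Filter ℝ} {m : ℝ}, Tendsto (fun x : ℝ => |x|) l atTop →
      Tendsto (tau c) l (𝓝 m) → Tendsto A l (𝓝 (-m)) := by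
    intro l m hl hm
    have t1 := tendsto_eta h2 hl
    have t2 : Tendsto (fun x => eta c x * (1 - eta c x)⁻¹) l (𝓝 0) := by
      simpa using t1.mul ((t1.const_sub 1).inv₀ (by norm_num))
    have := ((((tendsto_mul_eta h2 hl).mul t2).const_mul (-(c ^ 2 / (2 * (2 - c ^ 2))))).sub
      ((hm.mul t2).const_mul (1 / (2 - c ^ 2)))).sub hm
    rwa [mul_zero, mul_zero, mul_zero, mul_zero, sub_zero, zero_sub] at this
  rw [integral_of_hasDerivAt_of_tendsto hd
    ((integrable_mul_of_memLp (memLp_eta h2) (memLp_velC h0 h2)).add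
      (integrable_mul_of_memLp (memLp_vel h0 h2) (memLp_etaC h2)))
    (hlim tendsto_abs_atBot_atTop (tendsto_tau_atBot h2))
    (hlim tendsto_abs_atTop_atTop (tendsto_tau_atTop h2))]
  ring

end DarkSoliton

/-! ### Weighted control of the deviation from the line spanned by η -/

namespace DarkSoliton

open MeasureTheory Set Filter Topology

variable {c : ℝ}

/-- Deviation of `u₁` from the multiple of `η_c` with the same value at the origin. -/
noncomputable def dev (c : ℝ) (p : ℝ → ℝ) (x : ℝ) : ℝ := p x - p 0 / eta c 0 * eta c x

theorem memLp_dev (h2 : c ^ 2 < 2) {p : ℝ → ℝ} (hp : MemLp p 2 volume) :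
    MemLp (dev c p) 2 volume :=
  hp.sub ((memLp_eta h2).const_mul _)

/-- A pointwise bound for the deviation in terms of the weighted norm of the slope. -/
theorem dev_sq_mul_eta_le (h2 : c ^ 2 < 2) {p p₁ : ℝ → ℝ} (dp : ∀ x, HasDerivAt p (p₁ x) x)
    (cp₁ : Continuous p₁) (hp : MemLp p 2 volume) (hp₁ : MemLp p₁ 2 volume) (x : ℝ) :
    dev c p x ^ 2 * eta c x ≤ |x| * ∫ y, eta c y * slope c p p₁ y ^ 2 := by
  have cη := continuous_eta h2
  have cτ := continuous_tau h2
  have cp : Continuous p := continuous_iff_continuousAt.2 fun x => (dp x).continuousAt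
  have cs : Continuous (slope c p p₁) := cp₁.add (cτ.mul cp)
  have cs' : Continuous fun y => slope c p p₁ y / eta c y :=
    cs.div cη fun y => (eta_pos h2 y).ne'
  have hint : Integrable fun y => eta c y * slope c p p₁ y ^ 2 :=
    (isBddCont_eta h2).integrable_mul_sq (memLp_slope h2 hp hp₁)
  have hd : ∀ y, HasDerivAt (fun z => p z / eta c z) (slope c p p₁ y / eta c y) y := by
    intro y
    have hη := eta_pos h2 y
    refine ((dp y).div (hasDerivAt_eta h2 y) hη.ne').congr_deriv ?_
    rw [slope]
    field_simp
    ring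
  have ftc : ∫ y in (0 : ℝ)..x, slope c p p₁ y / eta c y = p x / eta c x - p 0 / eta c 0 :=
    intervalIntegral.integral_eq_sub_of_hasDerivAt (fun y _ => hd y) (cs'.intervalIntegrable _ _)
  have hη := eta_pos h2 x
  have hdev : dev c p x = eta c x * ∫ y in (0 : ℝ)..x, slope c p p₁ y / eta c y := by
    rw [ftc, dev]
    field_simp
  have hcs : (∫ y in (0 : ℝ)..x, slope c p p₁ y / eta c y) ^ 2 ≤
      |x| * ∫ y in uIoc 0 x, (slope c p p₁ y / eta c y) ^ 2 := by
    rw [← sq_abs, intervalIntegral.abs_integral_eq_abs_integral_uIoc, sq_abs]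
    have hfin : IsFiniteMeasure (volume.restrict (uIoc 0 x)) :=
      ⟨by rw [Measure.restrict_apply_univ, Real.volume_uIoc]; exact ENNReal.ofReal_lt_top⟩
    have m1 : MemLp (fun _ : ℝ => (1 : ℝ)) 2 (volume.restrict (uIoc 0 x)) := memLp_const 1
    have m2 : MemLp (fun y => slope c p p₁ y / eta c y) 2 (volume.restrict (uIoc 0 x)) := by
      rw [memLp_two_iff_integrable_sq cs'.aestronglyMeasurable]
      exact (intervalIntegrable_iff.1 ((cs'.pow 2).intervalIntegrable 0 x))
    have := sq_integral_mul_le m1 m2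
    simpa [Real.volume_uIoc, Measure.real] using this
  -- Monotonicity of η in |x| gives η(x)³ ≤ η(y)³ on the domain of integration. Two of the three
  -- factors come from the square of η(x)∫s/η, the third from the η in the statement.
  have hmono : eta c x ^ 3 * ∫ y in uIoc 0 x, (slope c p p₁ y / eta c y) ^ 2 ≤
      ∫ y, eta c y * slope c p p₁ y ^ 2 := by
    rw [← integral_const_mul]
    refine le_trans (setIntegral_mono_on
      ((intervalIntegrable_iff.1 ((cs'.pow 2).intervalIntegrable 0 x)).const_mul _)
      hint.integrableOn measurableSet_uIoc fun y hy => ?_)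
      (setIntegral_le_integral hint (Eventually.of_forall fun y =>
        mul_nonneg (eta_pos h2 y).le (sq_nonneg _)))
    have hy' : |y| ≤ |x| := by
      have := abs_sub_left_of_mem_uIcc (uIoc_subset_uIcc hy)
      simpa using this
    have hle := eta_le_eta_of_abs_le h2 hy'
    have hηy := eta_pos h2 y
    rw [div_pow, ← mul_div_assoc, div_le_iff₀ (by positivity)]
    calc eta c x ^ 3 * slope c p p₁ y ^ 2 ≤ eta c y ^ 3 * slope c p p₁ y ^ 2 := by gcongr
      _ = _ := by ring
  rw [hdev]
  calc (eta c x * ∫ y in (0 : ℝ)..x, slope c p p₁ y / eta c y) ^ 2 * eta c x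
      = eta c x ^ 3 * (∫ y in (0 : ℝ)..x, slope c p p₁ y / eta c y) ^ 2 := by ring
    _ ≤ eta c x ^ 3 * (|x| * ∫ y in uIoc 0 x, (slope c p p₁ y / eta c y) ^ 2) := by gcongr
    _ = |x| * (eta c x ^ 3 * ∫ y in uIoc 0 x, (slope c p p₁ y / eta c y) ^ 2) := by ring
    _ ≤ _ := by gcongr

/-- The intermediate exponential rate `σ` with `√(2 - c²) < σ < 2 √(2 - c²)` and `σ ≤ √2`. -/
noncomputable def wRate (c : ℝ) : ℝ := min (Real.sqrt 2) (3 / 2 * rate c)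

theorem rate_lt_wRate (h0 : 0 < c ^ 2) (h2 : c ^ 2 < 2) : rate c < wRate c :=
  lt_min (rate_lt_sqrt_two h0) (by linarith [rate_pos h2])

theorem wRate_lt (h2 : c ^ 2 < 2) : wRate c < 2 * rate c :=
  (min_le_right _ _).trans_lt (by linarith [rate_pos h2])

/-- The weight `e^{-σ|x|}`. -/
noncomputable def wt (c x : ℝ) : ℝ := Real.exp (-(wRate c * |x|))

theorem wt_pos (x : ℝ) : 0 < wt c x := Real.exp_pos _

theorem isBddCont_wt (h2 : c ^ 2 < 2) : IsBddCont (wt c) := by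
  refine ⟨by unfold wt; fun_prop, 1, fun x => ?_⟩
  rw [abs_of_pos (wt_pos x), wt, Real.exp_le_one_iff, neg_nonpos]
  have : 0 ≤ wRate c := le_min (Real.sqrt_nonneg _) (by linarith [rate_pos h2])
  positivity

theorem exp_sqrt_two_le_wt (x : ℝ) : Real.exp (-(Real.sqrt 2 * |x|)) ≤ wt c x :=
  Real.exp_le_exp.2 (neg_le_neg (mul_le_mul_of_nonneg_right (min_le_left _ _) (abs_nonneg x)))

theorem wt_le_eta (h0 : 0 < c ^ 2) (h2 : c ^ 2 < 2) (x : ℝ) :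
    wt c x ≤ 2 / (2 - c ^ 2) * eta c x := by
  have hκ : 0 < 2 - c ^ 2 := by linarith
  have h := le_eta_exp h2 x
  have h3 : wt c x ≤ Real.exp (-(rate c * |x|)) :=
    Real.exp_le_exp.2 (neg_le_neg (mul_le_mul_of_nonneg_right (rate_lt_wRate h0 h2).le
      (abs_nonneg x)))
  rw [div_mul_eq_mul_div, le_div_iff₀ hκ]
  nlinarith

/-- `∫ e^{-σ|x|} f²`. -/
noncomputable def wNorm (c : ℝ) (f : ℝ → ℝ) : ℝ := ∫ x, wt c x * f x ^ 2

theorem wNorm_nonneg (f : ℝ → ℝ) : 0 ≤ wNorm c f :=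
  integral_nonneg fun x => mul_nonneg (wt_pos x).le (sq_nonneg _)

theorem wNorm_le (h0 : 0 < c ^ 2) (h2 : c ^ 2 < 2) {f : ℝ → ℝ} (hf : MemLp f 2 volume) :
    wNorm c f ≤ 2 / (2 - c ^ 2) * ∫ x, eta c x * f x ^ 2 := by
  rw [wNorm, ← integral_const_mul]
  refine integral_mono ((isBddCont_wt h2).integrable_mul_sq hf)
    (((isBddCont_eta h2).integrable_mul_sq hf).const_mul _) fun x => ?_
  simp only
  rw [← mul_assoc]
  exact mul_le_mul_of_nonneg_right (wt_le_eta h0 h2 x) (sq_nonneg _)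

/-- The squared deviation grows at most like |x| e^{√(2-c²)|x|}, so the weight leaves |x| e^{-d|x|}
with d = σ - √(2-c²) > 0. Half of d absorbs |x|; the other half is integrated. -/
theorem wNorm_dev_le (h0 : 0 < c ^ 2) (h2 : c ^ 2 < 2) {p p₁ : ℝ → ℝ}
    (dp : ∀ x, HasDerivAt p (p₁ x) x) (cp₁ : Continuous p₁) (hp : MemLp p 2 volume)
    (hp₁ : MemLp p₁ 2 volume) :
    wNorm c (dev c p) ≤ 16 / ((2 - c ^ 2) * (wRate c - rate c) ^ 2) *
      ∫ y, eta c y * slope c p p₁ y ^ 2 := by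
  have hκ : 0 < 2 - c ^ 2 := by linarith
  have hd : 0 < wRate c - rate c := sub_pos.2 (rate_lt_wRate h0 h2)
  have hN0 : 0 ≤ ∫ y, eta c y * slope c p p₁ y ^ 2 :=
    integral_nonneg fun y => mul_nonneg (eta_pos h2 y).le (sq_nonneg _)
  have hdev := dev_sq_mul_eta_le h2 dp cp₁ hp hp₁
  generalize (∫ y, eta c y * slope c p p₁ y ^ 2) = N at *
  obtain ⟨d, hdd⟩ : ∃ d, d = wRate c - rate c := ⟨_, rfl⟩
  rw [← hdd] at hd ⊢
  have key : ∀ x, wt c x * dev c p x ^ 2 ≤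
      4 * N / ((2 - c ^ 2) * d) * Real.exp (-(d / 2 * |x|)) := by
    intro x
    have h1 := hdev x
    have h3 := le_eta_exp h2 x
    have hx : |x| ≤ 2 / d * Real.exp (d / 2 * |x|) := by
      have := Real.add_one_le_exp (d / 2 * |x|)
      rw [div_mul_eq_mul_div, le_div_iff₀ hd]
      linarith
    have hE := Real.exp_pos (-(rate c * |x|))
    have h4 : dev c p x ^ 2 * ((2 - c ^ 2) / 2 * Real.exp (-(rate c * |x|))) ≤
        2 / d * Real.exp (d / 2 * |x|) * N :=
      ((mul_le_mul_of_nonneg_left h3 (sq_nonneg _)).trans h1).trans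
        (mul_le_mul_of_nonneg_right hx hN0)
    have e1 : wt c x = Real.exp (-(rate c * |x|)) * Real.exp (-(d * |x|)) := by
      rw [wt, ← Real.exp_add]; congr 1; rw [hdd]; ring
    have e2 : Real.exp (-(d / 2 * |x|)) = Real.exp (d / 2 * |x|) * Real.exp (-(d * |x|)) := by
      rw [← Real.exp_add]; congr 1; ring
    have h5 := mul_le_mul_of_nonneg_right h4 (mul_nonneg (div_nonneg zero_le_two hκ.le)
      (Real.exp_pos (-(d * |x|))).le)
    rw [e1, e2]
    refine le_trans (le_of_eq ?_) (h5.trans (le_of_eq ?_))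
    · field_simp
    · field_simp
      ring
  have hi := (integrable_exp_neg_mul_abs (half_pos hd)).const_mul (4 * N / ((2 - c ^ 2) * d))
  refine (integral_mono ((isBddCont_wt h2).integrable_mul_sq (memLp_dev h2 hp)) hi key).trans
    (le_of_eq ?_)
  rw [integral_const_mul, integral_exp_neg_mul_abs (half_pos hd)]
  field_simp
  ring

end DarkSoliton

/-! ### Control of the component along Q_c, and coercivity with explicit constants -/

namespace DarkSoliton

open MeasureTheory Set Filter Topology

variable {c : ℝ}

noncomputable section

/-- Bound for the coefficients that express `u₂` through `resid`, `slope` and `u₁`. -/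
def coefBound (c : ℝ) : ℝ := 4 / c ^ 4

/-- Bound for `∂_c Q_c` relative to `(1 + |x|) η_c`. -/
def speedBound (c : ℝ) : ℝ := 20 / (c ^ 4 * (2 - c ^ 2))

/-- Bound for `∫ ((1 + |x|) η_c)² e^{σ|x|}`. -/
def massBound (c : ℝ) : ℝ :=
  16 * (1 + 4 / (2 * rate c - wRate c)) ^ 2 * (4 / (2 * rate c - wRate c))

/-- Constant in the bound for the component along `Q_c`. -/
def multBound (c : ℝ) : ℝ :=
  3 * (speedBound c * coefBound c) ^ 2 * massBound c / (2 - c ^ 2)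

/-- Constant in the bound for the weighted norms. -/
def normBound (c : ℝ) : ℝ := 2 / (2 - c ^ 2) + 16 / ((2 - c ^ 2) * (wRate c - rate c) ^ 2)

/-- The coercivity constant. -/
def coercConst (c : ℝ) : ℝ :=
  c ^ 2 / 4 / (normBound c * (16 * coefBound c ^ 2 * (1 + 2 * multBound c)))

end

theorem sq_wt_half (x : ℝ) : Real.exp (-(wRate c / 2 * |x|)) ^ 2 = wt c x := by
  rw [← Real.exp_nat_mul, wt]
  congr 1
  push_cast
  ring

/-- Weighted Cauchy–Schwarz inequality against `(1 + |x|) η_c`. -/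
theorem sq_integral_weight_mul_le (h2 : c ^ 2 < 2) {h : ℝ → ℝ} (hh : MemLp h 2 volume) :
    (∫ x, (1 + |x|) * eta c x * h x) ^ 2 ≤ massBound c * wNorm c h := by
  have hd : 0 < 2 * rate c - wRate c := sub_pos.2 (wRate_lt h2)
  obtain ⟨d, hdd⟩ : ∃ d, d = 2 * rate c - wRate c := ⟨_, rfl⟩
  rw [massBound, ← hdd]
  rw [← hdd] at hd
  have cη := continuous_eta h2
  -- The exponential factors combine to decay rate √(2-c²) - σ/2 = d/2, and half of it is spent on 1
  -- + |x|.
  have hbound : ∀ x : ℝ, ((1 + |x|) * eta c x * Real.exp (wRate c / 2 * |x|)) ≤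
      4 * (1 + 4 / d) * Real.exp (-(d / 4 * |x|)) := by
    intro x
    have h1 := one_add_abs_le_exp (show 0 < d / 4 by positivity) x
    have h3 : eta c x ≤ 4 * Real.exp (-(rate c * |x|)) :=
      (eta_le_exp h2 x).trans
        (mul_le_mul_of_nonneg_right (by nlinarith [sq_nonneg c]) (Real.exp_pos _).le)
    have h4 : (1 + |x|) * eta c x * Real.exp (wRate c / 2 * |x|) ≤
        ((1 + 1 / (d / 4)) * Real.exp (d / 4 * |x|)) * (4 * Real.exp (-(rate c * |x|))) *
          Real.exp (wRate c / 2 * |x|) :=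
      mul_le_mul_of_nonneg_right (mul_le_mul h1 h3 (eta_pos h2 x).le (by positivity))
        (Real.exp_pos _).le
    refine h4.trans (le_of_eq ?_)
    have e : Real.exp (-(d / 4 * |x|)) = Real.exp (d / 4 * |x|) * Real.exp (-(rate c * |x|)) *
        Real.exp (wRate c / 2 * |x|) := by
      rw [← Real.exp_add, ← Real.exp_add]
      congr 1
      rw [hdd]
      ring
    rw [e, one_div_div]
    ring
  have hpos : ∀ x : ℝ, 0 ≤ (1 + |x|) * eta c x * Real.exp (wRate c / 2 * |x|) := fun x =>
    mul_nonneg (mul_nonneg (by positivity) (eta_pos h2 x).le) (Real.exp_pos _).le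
  have m1 : MemLp (fun x => (1 + |x|) * eta c x * Real.exp (wRate c / 2 * |x|)) 2 volume :=
    memLp_two_of_abs_le_exp (by fun_prop) (d := d / 4) (by positivity) fun x => by
      rw [abs_of_nonneg (hpos x)]; exact hbound x
  have m2 : MemLp (fun x => Real.exp (-(wRate c / 2 * |x|)) * h x) 2 volume := by
    have hw : 0 ≤ wRate c := le_min (Real.sqrt_nonneg _) (by linarith [rate_pos h2])
    refine IsBddCont.memLp_mul ⟨by fun_prop, 1, fun x => ?_⟩ hh
    rw [Real.abs_exp, Real.exp_le_one_iff, neg_nonpos]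
    positivity
  have hcs := sq_integral_mul_le m1 m2
  have e1 : ∀ x, (1 + |x|) * eta c x * Real.exp (wRate c / 2 * |x|) *
      (Real.exp (-(wRate c / 2 * |x|)) * h x) = (1 + |x|) * eta c x * h x := by
    intro x
    rw [Real.exp_neg]
    have := Real.exp_pos (wRate c / 2 * |x|)
    field_simp
  simp only [e1, mul_pow _ (h _), sq_wt_half] at hcs
  refine hcs.trans (mul_le_mul_of_nonneg_right ?_ (wNorm_nonneg h))
  have hi := (integrable_exp_neg_mul_abs (half_pos hd)).const_mul ((4 * (1 + 4 / d)) ^ 2)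
  refine (integral_mono m1.integrable_sq hi fun x => ?_).trans (le_of_eq ?_)
  · refine (pow_le_pow_left₀ (hpos x) (hbound x) 2).trans (le_of_eq ?_)
    rw [mul_pow, ← Real.exp_nat_mul]
    congr 2
    push_cast
    ring
  · rw [integral_const_mul, integral_exp_neg_mul_abs (half_pos hd)]
    field_simp
    ring

theorem coefBound_ge (h0 : 0 < c ^ 2) (h2 : c ^ 2 < 2) :
    1 ≤ coefBound c ∧ 2 / c ^ 2 ≤ coefBound c := by
  have h4 : c ^ 4 = (c ^ 2) ^ 2 := by ring
  unfold coefBound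
  rw [h4]
  constructor
  · rw [le_div_iff₀ (by positivity)]; nlinarith
  · rw [div_le_div_iff₀ h0 (by positivity)]; nlinarith

theorem abs_vel_coef_le (h0 : 0 < c ^ 2) (h2 : c ^ 2 < 2) (x : ℝ) :
    (c / (2 * (1 - eta c x))) ^ 2 ≤ coefBound c ∧
      |c / (2 * (1 - eta c x))| ≤ coefBound c := by
  have hk : c ^ 2 / 2 ≤ 1 - eta c x := by linarith [two_mul_eta_le h2 x]
  have hk0 := one_sub_eta_pos h0 h2 x
  have hc0 : c ≠ 0 := by rintro rfl; norm_num at h0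
  have h : (c / (2 * (1 - eta c x))) ^ 2 ≤ coefBound c := by
    rw [div_pow, coefBound, show c ^ 4 = (c ^ 2) ^ 2 by ring,
      div_le_div_iff₀ (by positivity) (by positivity)]
    have h3 : c ^ 2 ≤ 2 * (1 - eta c x) := by linarith
    have h4 := pow_le_pow_left₀ h0.le h3 2
    nlinarith [pow_pos hk0 2]
  refine ⟨h, abs_le_of_sq_le_sq ?_ (by linarith [(coefBound_ge h0 h2).1])⟩
  nlinarith [(coefBound_ge h0 h2).1]

theorem abs_slope_coef_le (h0 : 0 < c ^ 2) (h2 : c ^ 2 < 2) (x : ℝ) :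
    |c * tau c x / (2 * (1 - eta c x) * (3 - c ^ 2 - 3 * eta c x))| ≤ coefBound c := by
  have hk : c ^ 2 / 2 ≤ 1 - eta c x := by linarith [two_mul_eta_le h2 x]
  have hk0 := one_sub_eta_pos h0 h2 x
  have hn := denom_lower h2 x
  have hn0 := denom_pos h0 h2 x
  have hc0 : c ≠ 0 := by rintro rfl; norm_num at h0
  have hnum : |c * tau c x| ≤ 2 := by
    refine abs_le_of_sq_le_sq ?_ (by norm_num)
    rw [mul_pow, tau_sq h2]
    nlinarith [eta_pos h2 x]
  rw [abs_div, abs_of_pos (show 0 < 2 * (1 - eta c x) * (3 - c ^ 2 - 3 * eta c x) by positivity),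
    div_le_iff₀ (by positivity)]
  calc |c * tau c x| ≤ 2 := hnum
    _ = coefBound c * (2 * (c ^ 2 / 2) * (c ^ 2 / 2)) := by
        rw [coefBound]; field_simp; norm_num
    _ ≤ _ := by
        have : 0 ≤ coefBound c := by linarith [(coefBound_ge h0 h2).1]
        gcongr

/-- Decomposition of `u₂`. -/
theorem snd_eq (h0 : 0 < c ^ 2) (h2 : c ^ 2 < 2) (p p₁ q : ℝ → ℝ) (x : ℝ) :
    q x = resid c p p₁ q x
      - c * tau c x / (2 * (1 - eta c x) * (3 - c ^ 2 - 3 * eta c x)) * slope c p p₁ x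
      + c / (2 * (1 - eta c x)) * p x := by
  have hk := one_sub_eta_pos h0 h2 x
  have hn := denom_pos h0 h2 x
  have hη := eta_eq_tau_sq h2 x
  rw [resid, slope]
  generalize eta c x = η at *
  generalize tau c x = τ at *
  subst hη
  -- The coefficients of p combine because (1 - η) + τ² = 3 - c² - 3η.
  have e1 : 1 - (2 - c ^ 2 - τ ^ 2) / 2 = (c ^ 2 + τ ^ 2) / 2 := by ring
  have e2 : 3 - c ^ 2 - 3 * ((2 - c ^ 2 - τ ^ 2) / 2) = (c ^ 2 + 3 * τ ^ 2) / 2 := by ring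
  rw [e1] at hk ⊢
  rw [e2] at hn ⊢
  have hk' : c ^ 2 + τ ^ 2 ≠ 0 := by intro h; rw [h] at hk; simp at hk
  have hn' : c ^ 2 + 3 * τ ^ 2 ≠ 0 := by intro h; rw [h] at hn; simp at hn
  field_simp
  ring

/-- The sum of the weighted norms of the three components of `u` modulo `Q_c`. -/
noncomputable def wTotal (c : ℝ) (p p₁ q : ℝ → ℝ) : ℝ :=
  wNorm c (slope c p p₁) + wNorm c (resid c p p₁ q) + wNorm c (dev c p)

/-- The orthogonality condition controls the component along `Q_c`. -/
theorem mult_sq_le (h0 : 0 < c ^ 2) (h2 : c ^ 2 < 2) {p p₁ q : ℝ → ℝ} (hp : MemLp p 2 volume)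
    (hp₁ : MemLp p₁ 2 volume) (hq : MemLp q 2 volume)
    (horth : ∫ x, (p x * velC c x + q x * etaC c x) = 0) :
    (p 0 / eta c 0) ^ 2 ≤ multBound c * wTotal c p p₁ q := by
  have hκ : 0 < 2 - c ^ 2 := by linarith
  have ms := memLp_slope h2 hp hp₁
  have mr := memLp_resid h2 h0 hp hp₁ hq
  have md := memLp_dev h2 hp
  have hK := coefBound_ge h0 h2
  have mv := memLp_velC h0 h2
  have me := memLp_etaC h2
  have mvel := memLp_vel h0 h2
  obtain ⟨m, hm⟩ : ∃ m, m = p 0 / eta c 0 := ⟨_, rfl⟩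
  -- The constraint integrand of u - mQ_c. Its integral is 2m√(2-c²), while pointwise it involves
  -- only `dev`, `resid` and `slope`.
  let R : ℝ → ℝ := fun x => p x * velC c x + q x * etaC c x
    - m * (eta c x * velC c x + vel c x * etaC c x)
  let h : ℝ → ℝ := fun x => |dev c p x| + |resid c p p₁ q x| + |slope c p p₁ x|
  have i1 : Integrable fun x => p x * velC c x + q x * etaC c x :=
    (integrable_mul_of_memLp hp mv).add (integrable_mul_of_memLp hq me)
  have i2 : Integrable fun x => eta c x * velC c x + vel c x * etaC c x :=
    (integrable_mul_of_memLp (memLp_eta h2) mv).add (integrable_mul_of_memLp mvel me)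
  have hR : ∫ x, R x = m * (2 * rate c) := by
    have := integral_sub i1 (i2.const_mul m)
    simp only [R]
    rw [this, horth, integral_const_mul, integral_eta_velC_add_vel_etaC h0 h2]
    ring
  have mh : MemLp h 2 volume := (md.abs.add mr.abs).add ms.abs
  have hRle : ∀ x, |R x| ≤ 2 * (speedBound c * coefBound c) * ((1 + |x|) * eta c x * h x) := by
    intro x
    have hk := one_sub_eta_pos h0 h2 x
    have e : R x = dev c p x * velC c x + (resid c p p₁ q x
        - c * tau c x / (2 * (1 - eta c x) * (3 - c ^ 2 - 3 * eta c x)) * slope c p p₁ x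
        + c / (2 * (1 - eta c x)) * dev c p x) * etaC c x := by
      have e1 := snd_eq h0 h2 p p₁ q x
      have e2 : vel c x = c / (2 * (1 - eta c x)) * eta c x := by rw [vel]; field_simp
      simp only [R]
      rw [e1, e2, dev, ← hm]
      ring
    have b1 := abs_slope_coef_le h0 h2 x
    have b2 := (abs_vel_coef_le h0 h2 x).2
    have b3 : |velC c x| ≤ speedBound c * ((1 + |x|) * eta c x) := abs_velC_le h0 h2 x
    have hw0 : 0 ≤ (1 + |x|) * eta c x := mul_nonneg (by positivity) (eta_pos h2 x).le
    have b4 : |etaC c x| ≤ speedBound c * ((1 + |x|) * eta c x) := by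
      refine (abs_etaC_le h2 x).trans (mul_le_mul_of_nonneg_right ?_ hw0)
      have hc0 : c ≠ 0 := by rintro rfl; norm_num at h0
      rw [speedBound, div_le_div_iff₀ hκ (by positivity)]
      have h4 : c ^ 4 = (c ^ 2) ^ 2 := by ring
      have : c ^ 4 ≤ 4 := by rw [h4]; nlinarith
      nlinarith
    rw [e]
    obtain ⟨W, hW⟩ : ∃ W, W = speedBound c * ((1 + |x|) * eta c x) := ⟨_, rfl⟩
    have hW0 : 0 ≤ W := by rw [hW]; exact (abs_nonneg _).trans b3
    rw [← hW] at b3 b4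
    have t : |resid c p p₁ q x
        - c * tau c x / (2 * (1 - eta c x) * (3 - c ^ 2 - 3 * eta c x)) * slope c p p₁ x
        + c / (2 * (1 - eta c x)) * dev c p x| ≤ coefBound c * h x := by
      refine (abs_add_le _ _).trans ((add_le_add_left (abs_sub _ _) _).trans ?_)
      rw [abs_mul, abs_mul]
      simp only [h]
      nlinarith [mul_le_mul_of_nonneg_right b1 (abs_nonneg (slope c p p₁ x)),
        mul_le_mul_of_nonneg_right b2 (abs_nonneg (dev c p x)),
        mul_le_mul_of_nonneg_right hK.1 (abs_nonneg (resid c p p₁ q x))]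
    have hdh : |dev c p x| ≤ coefBound c * h x := by
      have : |dev c p x| ≤ h x := by
        simp only [h]; linarith [abs_nonneg (resid c p p₁ q x), abs_nonneg (slope c p p₁ x)]
      nlinarith [abs_nonneg (dev c p x)]
    have hh0 : 0 ≤ coefBound c * h x := (abs_nonneg _).trans hdh
    refine (abs_add_le _ _).trans ?_
    rw [abs_mul, abs_mul]
    refine (add_le_add (mul_le_mul hdh b3 (abs_nonneg _) hh0)
      (mul_le_mul t b4 (abs_nonneg _) hh0)).trans (le_of_eq ?_)
    rw [hW]
    ring
  have iw : Integrable fun x => (1 + |x|) * eta c x * h x :=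
    integrable_mul_of_memLp (memLp_weight h2) mh
  have habs : |m * (2 * rate c)| ≤
      2 * (speedBound c * coefBound c) * ∫ x, (1 + |x|) * eta c x * h x := by
    rw [← hR, ← integral_const_mul, ← Real.norm_eq_abs]
    exact norm_integral_le_of_norm_le (iw.const_mul _) (Eventually.of_forall hRle)
  have hN : wNorm c h ≤ 3 * wTotal c p p₁ q := by
    have is := (isBddCont_wt h2).integrable_mul_sq ms
    have ir := (isBddCont_wt h2).integrable_mul_sq mr
    have id' := (isBddCont_wt h2).integrable_mul_sq md
    have j1 := integral_add is ir
    have j2 := integral_add (is.add ir) id'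
    simp only [Pi.add_apply] at j2
    rw [wTotal, wNorm, wNorm, wNorm, wNorm, ← j1, ← j2, ← integral_const_mul]
    refine integral_mono ((isBddCont_wt h2).integrable_mul_sq mh)
      (((is.add ir).add id').const_mul 3) fun x => ?_
    simp only [h]
    have hw := wt_pos (c := c) x
    rw [← mul_add, ← mul_add, mul_left_comm]
    refine mul_le_mul_of_nonneg_left ?_ hw.le
    rw [← sq_abs (slope c p p₁ x), ← sq_abs (resid c p p₁ q x), ← sq_abs (dev c p x)]
    nlinarith [sq_nonneg (|dev c p x| - |resid c p p₁ q x|),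
      sq_nonneg (|dev c p x| - |slope c p p₁ x|),
      sq_nonneg (|resid c p p₁ q x| - |slope c p p₁ x|)]
  have hcs := sq_integral_weight_mul_le h2 mh
  have hmass : 0 ≤ massBound c := by
    have := sub_pos.2 (wRate_lt h2)
    unfold massBound
    positivity
  have hsq := pow_le_pow_left₀ (abs_nonneg _) habs 2
  rw [sq_abs, mul_pow, mul_pow 2 (rate c), rate_sq h2, mul_pow] at hsq
  rw [← hm, multBound, div_mul_eq_mul_div, le_div_iff₀ hκ]
  have h5 := mul_le_mul_of_nonneg_left (hcs.trans (mul_le_mul_of_nonneg_left hN hmass))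
    (sq_nonneg (2 * (speedBound c * coefBound c)))
  linarith

/-- Lower bound for the quadratic form. -/
theorem wTotal_le (h0 : 0 < c ^ 2) (h2 : c ^ 2 < 2) {p p₁ q : ℝ → ℝ}
    (dp : ∀ x, HasDerivAt p (p₁ x) x) (cp₁ : Continuous p₁) (hp : MemLp p 2 volume)
    (hp₁ : MemLp p₁ 2 volume) (hq : MemLp q 2 volume) :
    c ^ 2 / 4 * wTotal c p p₁ q ≤ normBound c *
      (2 * (∫ x, mu c x * resid c p p₁ q x ^ 2)
        + 3 / 2 * ∫ x, eta c x / (3 - c ^ 2 - 3 * eta c x) * slope c p p₁ x ^ 2) := by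
  have hκ : 0 < 2 - c ^ 2 := by linarith
  have ms := memLp_slope h2 hp hp₁
  have mr := memLp_resid h2 h0 hp hp₁ hq
  have a1 : c ^ 2 / 2 * (∫ x, eta c x * resid c p p₁ q x ^ 2) ≤
      ∫ x, mu c x * resid c p p₁ q x ^ 2 := by
    rw [← integral_const_mul]
    refine integral_mono (((isBddCont_eta h2).integrable_mul_sq mr).const_mul _)
      (integrable_mu_resid h2 h0 hp hp₁ hq) fun x => ?_
    simp only [mu_eq h2]
    rw [← mul_assoc, mul_comm (c ^ 2 / 2)]
    exact mul_le_mul_of_nonneg_right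
      (mul_le_mul_of_nonneg_left (denom_lower h2 x) (eta_pos h2 x).le) (sq_nonneg _)
  have a2 : 1 / 3 * (∫ x, eta c x * slope c p p₁ x ^ 2) ≤
      ∫ x, eta c x / (3 - c ^ 2 - 3 * eta c x) * slope c p p₁ x ^ 2 := by
    rw [← integral_const_mul]
    refine integral_mono (((isBddCont_eta h2).integrable_mul_sq ms).const_mul _)
      (integrable_slope h2 h0 hp hp₁) fun x => ?_
    simp only
    rw [← mul_assoc]
    refine mul_le_mul_of_nonneg_right ?_ (sq_nonneg _)
    rw [le_div_iff₀ (denom_pos h0 h2 x)]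
    nlinarith [denom_upper h2 x, eta_pos h2 x]
  have b1 := wNorm_le h0 h2 ms
  have b2 := wNorm_le h0 h2 mr
  have b3 := wNorm_dev_le h0 h2 dp cp₁ hp hp₁
  have n1 : 0 ≤ ∫ x, eta c x * slope c p p₁ x ^ 2 :=
    integral_nonneg fun y => mul_nonneg (eta_pos h2 y).le (sq_nonneg _)
  have n2 : 0 ≤ ∫ x, eta c x * resid c p p₁ q x ^ 2 :=
    integral_nonneg fun y => mul_nonneg (eta_pos h2 y).le (sq_nonneg _)
  have k1 : 0 ≤ 2 / (2 - c ^ 2) := by positivity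
  have k2 : 0 ≤ 16 / ((2 - c ^ 2) * (wRate c - rate c) ^ 2) := by positivity
  rw [wTotal, normBound]
  generalize (∫ x, eta c x * slope c p p₁ x ^ 2) = N at *
  generalize (∫ x, eta c x * resid c p p₁ q x ^ 2) = N' at *
  generalize 2 / (2 - c ^ 2) = k at *
  generalize 16 / ((2 - c ^ 2) * (wRate c - rate c) ^ 2) = k' at *
  -- The two integrals contribute c² N' and N/2; both coefficients are at least c²/4 because c² < 2.
  have s1 : c ^ 2 / 4 * (N + N') ≤ 2 * (∫ x, mu c x * resid c p p₁ q x ^ 2)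
        + 3 / 2 * ∫ x, eta c x / (3 - c ^ 2 - 3 * eta c x) * slope c p p₁ x ^ 2 := by
    nlinarith
  have s2 : wNorm c (slope c p p₁) + wNorm c (resid c p p₁ q) + wNorm c (dev c p) ≤
      (k + k') * (N + N') := by nlinarith [mul_nonneg k2 n2]
  calc _ ≤ c ^ 2 / 4 * ((k + k') * (N + N')) := by gcongr
    _ = (k + k') * (c ^ 2 / 4 * (N + N')) := by ring
    _ ≤ _ := mul_le_mul_of_nonneg_left s1 (add_nonneg k1 k2)

/-- Upper bound for the exponentially weighted norm. -/
theorem integral_weighted_le (h0 : 0 < c ^ 2) (h2 : c ^ 2 < 2) {p p₁ q : ℝ → ℝ}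
    (hp : MemLp p 2 volume) (hp₁ : MemLp p₁ 2 volume) (hq : MemLp q 2 volume) :
    ∫ x, (p₁ x ^ 2 + p x ^ 2 + q x ^ 2) * Real.exp (-(Real.sqrt 2 * |x|)) ≤
      16 * coefBound c ^ 2 * (wTotal c p p₁ q + 2 * (p 0 / eta c 0) ^ 2) := by
  have ms := memLp_slope h2 hp hp₁
  have mr := memLp_resid h2 h0 hp hp₁ hq
  have md := memLp_dev h2 hp
  have hK := (coefBound_ge h0 h2).1
  obtain ⟨m, hm⟩ : ∃ m, m = p 0 / eta c 0 := ⟨_, rfl⟩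
  have is := (isBddCont_wt h2).integrable_mul_sq ms
  have ir := (isBddCont_wt h2).integrable_mul_sq mr
  have id' := (isBddCont_wt h2).integrable_mul_sq md
  have hs2 : 0 < Real.sqrt 2 := by positivity
  have ie := (integrable_exp_neg_mul_abs hs2).const_mul (m ^ 2)
  -- The mη part keeps the weight e^{-√2|x|}, using η ≤ 1. Its total mass 2/√2 ≤ 2 gives the factor
  -- 2 in front of m².
  have hpt : ∀ x, (p₁ x ^ 2 + p x ^ 2 + q x ^ 2) * Real.exp (-(Real.sqrt 2 * |x|)) ≤
      16 * coefBound c ^ 2 * (wt c x * slope c p p₁ x ^ 2 + wt c x * resid c p p₁ q x ^ 2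
        + wt c x * dev c p x ^ 2 + m ^ 2 * Real.exp (-(Real.sqrt 2 * |x|))) := by
    intro x
    have e1 := snd_eq h0 h2 p p₁ q x
    have e2 : p₁ x = slope c p p₁ x - tau c x * p x := by rw [slope]; ring
    have e3 : p x = dev c p x + m * eta c x := by rw [dev, ← hm]; ring
    have b1 := abs_slope_coef_le h0 h2 x
    have b2 := (abs_vel_coef_le h0 h2 x).1
    have hτ := tau_sq h2 x
    have hη := eta_pos h2 x
    have hη1 := one_sub_eta_pos h0 h2 x
    have b1' := pow_le_pow_left₀ (abs_nonneg _) b1 2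
    rw [sq_abs] at b1'
    generalize c * tau c x / (2 * (1 - eta c x) * (3 - c ^ 2 - 3 * eta c x)) = β at *
    generalize c / (2 * (1 - eta c x)) = γ at *
    generalize coefBound c = K at *
    generalize slope c p p₁ x = s at *
    generalize resid c p p₁ q x = r at *
    generalize dev c p x = w at *
    have f1 : p₁ x ^ 2 ≤ 2 * s ^ 2 + 4 * p x ^ 2 := by
      have h1 : (tau c x * p x) ^ 2 ≤ 2 * p x ^ 2 := by
        rw [mul_pow]; exact mul_le_mul_of_nonneg_right (by nlinarith) (sq_nonneg _)
      rw [e2]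
      nlinarith [sq_nonneg (s + tau c x * p x)]
    have f2 : q x ^ 2 ≤ 3 * r ^ 2 + 3 * (K ^ 2 * s ^ 2) + 3 * (K * p x ^ 2) := by
      have h1 : (β * s) ^ 2 ≤ K ^ 2 * s ^ 2 := by
        rw [mul_pow]; exact mul_le_mul_of_nonneg_right b1' (sq_nonneg _)
      have h3 : (γ * p x) ^ 2 ≤ K * p x ^ 2 := by
        rw [mul_pow]; exact mul_le_mul_of_nonneg_right b2 (sq_nonneg _)
      rw [e1]
      nlinarith [sq_nonneg (r + β * s), sq_nonneg (r - γ * p x), sq_nonneg (β * s + γ * p x)]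
    have f3 : p x ^ 2 ≤ 2 * w ^ 2 + 2 * m ^ 2 := by
      have h1 : (m * eta c x) ^ 2 ≤ m ^ 2 * 1 := by
        rw [mul_pow]; exact mul_le_mul_of_nonneg_left (by nlinarith) (sq_nonneg _)
      rw [e3]
      nlinarith [sq_nonneg (w - m * eta c x)]
    have hKK : K ≤ K ^ 2 := by nlinarith
    have f4 : p₁ x ^ 2 + p x ^ 2 + q x ^ 2 ≤ 16 * K ^ 2 * (s ^ 2 + r ^ 2 + w ^ 2 + m ^ 2) := by
      have g1 : p₁ x ^ 2 + p x ^ 2 + q x ^ 2 ≤ 8 * K ^ 2 * (s ^ 2 + r ^ 2 + p x ^ 2) := by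
        nlinarith [mul_nonneg (sub_nonneg.2 hKK) (sq_nonneg (p x)),
          mul_nonneg (sub_nonneg.2 (hK.trans hKK)) (sq_nonneg (p x)),
          mul_nonneg (sub_nonneg.2 (hK.trans hKK)) (sq_nonneg s),
          mul_nonneg (sub_nonneg.2 (hK.trans hKK)) (sq_nonneg r)]
      nlinarith [mul_le_mul_of_nonneg_left f3 (sq_nonneg K), mul_nonneg (sq_nonneg K) (sq_nonneg s),
        mul_nonneg (sq_nonneg K) (sq_nonneg r)]
    have hE := Real.exp_pos (-(Real.sqrt 2 * |x|))
    have hle := exp_sqrt_two_le_wt (c := c) x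
    calc _ ≤ 16 * K ^ 2 * (s ^ 2 + r ^ 2 + w ^ 2 + m ^ 2) * Real.exp (-(Real.sqrt 2 * |x|)) :=
          mul_le_mul_of_nonneg_right f4 hE.le
      _ = 16 * K ^ 2 * ((s ^ 2 + r ^ 2 + w ^ 2) * Real.exp (-(Real.sqrt 2 * |x|))
          + m ^ 2 * Real.exp (-(Real.sqrt 2 * |x|))) := by ring
      _ ≤ 16 * K ^ 2 * ((s ^ 2 + r ^ 2 + w ^ 2) * wt c x
          + m ^ 2 * Real.exp (-(Real.sqrt 2 * |x|))) := by gcongr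
      _ = _ := by ring
  have ih := (((is.add ir).add id').add ie)
  refine (integral_mono_of_nonneg (Eventually.of_forall fun x =>
    mul_nonneg (by positivity) (Real.exp_pos _).le) (ih.const_mul (16 * coefBound c ^ 2))
    (Eventually.of_forall hpt)).trans ?_
  rw [integral_const_mul]
  have j1 := integral_add is ir
  have j2 := integral_add (is.add ir) id'
  have j3 := integral_add ((is.add ir).add id') ie
  simp only [Pi.add_apply] at j2 j3 ⊢
  rw [j3, j2, j1, integral_const_mul, integral_exp_neg_mul_abs hs2, ← hm, wTotal, wNorm, wNorm,
    wNorm]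
  refine mul_le_mul_of_nonneg_left ?_ (by positivity)
  have : 2 / Real.sqrt 2 ≤ 2 := by
    rw [div_le_iff₀ hs2]
    nlinarith [Real.one_lt_sqrt_two]
  nlinarith [sq_nonneg m]

theorem bounds_pos (h0 : 0 < c ^ 2) (h2 : c ^ 2 < 2) :
    0 < normBound c ∧ 0 < coefBound c ∧ 0 ≤ multBound c := by
  have hκ : 0 < 2 - c ^ 2 := by linarith
  have h4 : 0 < c ^ 4 := by rw [show c ^ 4 = (c ^ 2) ^ 2 by ring]; positivity
  have hd := sub_pos.2 (rate_lt_wRate h0 h2)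
  have hd' := sub_pos.2 (wRate_lt h2)
  unfold multBound normBound massBound speedBound coefBound
  refine ⟨by positivity, by positivity, by positivity⟩

theorem coercConst_pos (h0 : 0 < c ^ 2) (h2 : c ^ 2 < 2) : 0 < coercConst c := by
  obtain ⟨b1, b2, b3⟩ := bounds_pos h0 h2
  unfold coercConst
  positivity

/-- σ is a minimum of continuous functions of c, and the gaps σ - √(2-c²) and 2√(2-c²) - σ in the
denominators never vanish on this set. -/
theorem continuousOn_coercConst : ContinuousOn coercConst {c : ℝ | 0 < c ^ 2 ∧ c ^ 2 < 2} := by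
  intro c ⟨h0, h2⟩
  refine ContinuousAt.continuousWithinAt ?_
  have hκ : 0 < 2 - c ^ 2 := by linarith
  have h4 : c ^ 4 ≠ 0 := by
    rw [show c ^ 4 = (c ^ 2) ^ 2 by ring]; positivity
  have hd := sub_pos.2 (rate_lt_wRate h0 h2)
  have hd' := sub_pos.2 (wRate_lt h2)
  obtain ⟨b1, b2, b3⟩ := bounds_pos h0 h2
  have c7 : ContinuousAt (fun c : ℝ => 2 - c ^ 2) c := by fun_prop
  have ca : ContinuousAt rate c := by unfold rate; fun_prop
  have cw : ContinuousAt wRate c := continuousAt_const.min (continuousAt_const.mul ca)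
  have c1 : ContinuousAt coefBound c := by
    unfold coefBound; exact continuousAt_const.div (by fun_prop) h4
  have c2 : ContinuousAt speedBound c := by
    unfold speedBound
    exact continuousAt_const.div (by fun_prop) (mul_ne_zero h4 hκ.ne')
  have c3 : ContinuousAt massBound c := by
    have : ContinuousAt (fun c => 4 / (2 * rate c - wRate c)) c :=
      continuousAt_const.div ((continuousAt_const.mul ca).sub cw) hd'.ne'
    exact (continuousAt_const.mul ((continuousAt_const.add this).pow 2)).mul this
  have c4 : ContinuousAt multBound c :=
    ((continuousAt_const.mul ((c2.mul c1).pow 2)).mul c3).div (by fun_prop) hκ.ne'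
  have c5 : ContinuousAt normBound c :=
    (continuousAt_const.div c7 hκ.ne').add (continuousAt_const.div
      (c7.mul ((cw.sub ca).pow 2)) (mul_pos hκ (pow_pos hd 2)).ne')
  have c6 : ContinuousAt (fun c : ℝ => c ^ 2 / 4) c := by fun_prop
  exact c6.div (c5.mul ((continuousAt_const.mul (c1.pow 2)).mul
    (continuousAt_const.add (continuousAt_const.mul c4)))) (by positivity)

/-- With T = `wTotal`, K = `coefBound` and B = `multBound`, three bounds are chained: the weighted
norm is at most 16K²(T + 2m²), m² ≤ BT, and (c²/4)T is at most `normBound` times G. -/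
theorem coercivity (h0 : 0 < c ^ 2) (h2 : c ^ 2 < 2) {u : Pair} (hu : MemX 1 u)
    (horth : innerL2 u (opS (dcQ c)) = 0) :
    coercConst c * (∫ x : ℝ, (weakDeriv u.1 x ^ 2 + u.1 x ^ 2 + u.2 x ^ 2)
      * Real.exp (-(Real.sqrt 2 * |x|))) ≤ G c u := by
  obtain ⟨p, p₁, hp, dp, cp₁, mp, m1⟩ := MemH.exists_hasDerivAt hu.1
  have hp₁ := weakDeriv_ae_eq hp dp cp₁
  have mq : MemLp u.2 2 volume := MemH.memLp hu.2
  have mp₁ := m1.memLp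
  rw [dcQ_eq h0 h2] at horth
  have horth' : ∫ x, (p x * velC c x + u.2 x * etaC c x) = 0 := by
    rw [← horth, innerL2]
    exact integral_congr_ae (hp.mono fun x hx => by simp only [opS, hx])
  have e : ∫ x, (weakDeriv u.1 x ^ 2 + u.1 x ^ 2 + u.2 x ^ 2) * Real.exp (-(Real.sqrt 2 * |x|)) =
      ∫ x, (p₁ x ^ 2 + p x ^ 2 + u.2 x ^ 2) * Real.exp (-(Real.sqrt 2 * |x|)) := by
    refine integral_congr_ae ?_
    filter_upwards [hp, hp₁] with x h1 h3
    rw [h1, h3]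
  rw [e, G_eq h2 h0 hp hp₁ EventuallyEq.rfl]
  have t1 := integral_weighted_le h0 h2 mp mp₁ mq
  have t2 := mult_sq_le h0 h2 mp mp₁ mq horth'
  have t3 := wTotal_le h0 h2 dp cp₁ mp mp₁ mq
  obtain ⟨b1, b2, b3⟩ := bounds_pos h0 h2
  have t4 : 16 * coefBound c ^ 2 * (wTotal c p p₁ u.2 + 2 * (p 0 / eta c 0) ^ 2) ≤
      16 * coefBound c ^ 2 * (1 + 2 * multBound c) * wTotal c p p₁ u.2 := by
    rw [mul_assoc (16 * coefBound c ^ 2)]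
    exact mul_le_mul_of_nonneg_left (by linarith) (by positivity)
  rw [coercConst, div_mul_eq_mul_div, div_le_iff₀ (by positivity)]
  have t5 := mul_le_mul_of_nonneg_left (t1.trans t4) (show 0 ≤ c ^ 2 / 4 by positivity)
  have t6 := mul_le_mul_of_nonneg_left t3
    (show 0 ≤ 16 * coefBound c ^ 2 * (1 + 2 * multBound c) by positivity)
  refine t5.trans (le_trans (le_of_eq ?_) (t6.trans (le_of_eq ?_))) <;> ring

end DarkSoliton

theorem mainTheorem4 :
    -- on `X³`, the quadratic form is `G_c(u) = 2 ⟨S M_c u, H_c (J S u)⟩`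
    (∀ c : ℝ, 0 < |c| → |c| < Real.sqrt 2 → ∀ u : DarkSoliton.Pair, DarkSoliton.MemX 3 u →
      DarkSoliton.G c u =
        2 * DarkSoliton.innerL2 (DarkSoliton.opS (DarkSoliton.opM c u))
          (DarkSoliton.opH c (DarkSoliton.opJ (DarkSoliton.opS u)))) ∧
    -- coercivity
    ∃ Λ : ℝ → ℝ, ContinuousOn Λ {c : ℝ | 0 < |c| ∧ |c| < Real.sqrt 2} ∧
      ∀ c : ℝ, 0 < |c| → |c| < Real.sqrt 2 →
        0 < Λ c ∧
        ∀ u : DarkSoliton.Pair, DarkSoliton.MemX 1 u →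
          DarkSoliton.innerL2 u (DarkSoliton.opS (DarkSoliton.dcQ c)) = 0 →
          Λ c * (∫ x : ℝ, (DarkSoliton.weakDeriv u.1 x ^ 2 + u.1 x ^ 2 + u.2 x ^ 2)
              * Real.exp (-(Real.sqrt 2 * |x|))) ≤ DarkSoliton.G c u := by
  have conv : ∀ c : ℝ, 0 < |c| → |c| < Real.sqrt 2 → 0 < c ^ 2 ∧ c ^ 2 < 2 := by
    intro c h0 h2
    rw [← sq_abs]
    exact ⟨by positivity, (Real.lt_sqrt (abs_nonneg c)).1 h2⟩
  refine ⟨fun c h0 h2 u hu => DarkSoliton.G_eq_innerL2 (conv c h0 h2).1 (conv c h0 h2).2 hu,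
    DarkSoliton.coercConst, DarkSoliton.continuousOn_coercConst.mono fun c h => conv c h.1 h.2,
    fun c h0 h2 => ⟨DarkSoliton.coercConst_pos (conv c h0 h2).1 (conv c h0 h2).2,
      fun u hu ho => DarkSoliton.coercivity (conv c h0 h2).1 (conv c h0 h2).2 hu ho⟩⟩
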